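/- Theorem 2.4. In $L^2(\mathbb R,\mathbb C)$, with $\langle f,g\rangle=\int_{\mathbb R}\overline{f}\,g\,dx$, let $XP+PX$ be the operator defined on the Schwartz class by $Xf(x)=xf(x)$ and $Pf=-if'$, and let $\Phi(x)=\pi^{-1/4}e^{-x^2/2}$. For $\operatorname{Re}a>0$, real $b$, and $z\in\mathbb C$ with $|z|<1$, or with $|z|\le 1$ and $b>0$, let $$B(z;a,b)=\int_0^z w^{a-1}(1-w)^{b-1}\,dw$$ be the incomplete Beta function (integral along the straight segment, principal powers). It satisfies $$B(z;a,b)=z^a\sum_{n=0}^\infty\frac{(1-b)_n}{n!\,(a+n)}z^n,\qquad (x)_n=x(x+1)\cdots(x+n-1).$$ The operator $XP+PX$ has a self-adjoint extension $T$ with a spectral resolution $\{E_\lambda\mid\lambda\in\mathbb R\}$ (that is, $E_\lambda=E((-\infty,\lambda])$ and $T=\int_{\mathbb R}\lambda\,dE_\lambda$) and with bounded operators $e^{itT}=\int_{\mathbb R}e^{it\lambda}\,dE_\lambda$, $t\in\mathbb R$. For every self-adjoint extension $T$ of $XP+PX$ and its spectral resolution $\{E_\lambda\}$, and for every $\lambda\in\mathbb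 R$, the following integral converges absolutely and $$\langle\Phi,E_\lambda\Phi\rangle=\frac{1-i}{8\pi}\int_{-\infty}^{\lambda}\left(e^{-\frac{\pi t}{4}}B\!\left(-1;\tfrac{1-it}{4},\tfrac12\right)+e^{\frac{\pi t}{4}}B\!\left(-1;\tfrac{1+it}{4},\tfrac12\right)\right)dt .$$ Moreover, for every $t\in\mathbb R$, $$\langle\Phi,e^{itT}\Phi\rangle=(\operatorname{sech}2t)^{1/2}.$$ -/

import Mathlib

open MeasureTheory Filter Topology
open scoped SchwartzMap

noncomputable section

namespace Anticommutator

/-- The Hilbert space `L²(ℝ, ℂ)` (Lebesgue measure, inner product conjugate-linear in the first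
argument). -/
abbrev L2 : Type := Lp ℂ 2 (volume : Measure ℝ)

/-! ### The operator `XP + PX` on the Schwartz class -/

/-- The position operator `X f (x) = x f(x)` on the Schwartz class. -/
def position : 𝓢(ℝ, ℂ) →ₗ[ℂ] 𝓢(ℝ, ℂ) :=
  (SchwartzMap.smulLeftCLM ℂ (fun x : ℝ => (x : ℂ))).toLinearMap

/-- The momentum operator `P f = -i f'` on the Schwartz class. -/
def momentum : 𝓢(ℝ, ℂ) →ₗ[ℂ] 𝓢(ℝ, ℂ) :=
  (-Complex.I) • (SchwartzMap.derivCLM ℂ ℂ).toLinearMap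

theorem position_apply (f : 𝓢(ℝ, ℂ)) (x : ℝ) : position f x = (x : ℂ) * f x := by
  have h : Function.HasTemperateGrowth (fun x : ℝ => (x : ℂ)) := by fun_prop
  exact SchwartzMap.smulLeftCLM_apply_apply h f x

theorem momentum_apply (f : 𝓢(ℝ, ℂ)) (x : ℝ) : momentum f x = -Complex.I * deriv f x := by
  simp [momentum]

/-- `XP + PX` as a linear map of the Schwartz class to itself. -/
def schwartzAnticomm : 𝓢(ℝ, ℂ) →ₗ[ℂ] 𝓢(ℝ, ℂ) :=
  position ∘ₗ momentum + momentum ∘ₗ position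

/-- The embedding of the Schwartz class in `L²(ℝ, ℂ)`. -/
def schwartzToL2 : 𝓢(ℝ, ℂ) →ₗ[ℂ] L2 :=
  (SchwartzMap.toLpCLM ℂ ℂ 2 (volume : Measure ℝ)).toLinearMap

theorem schwartzToL2_injective : Function.Injective schwartzToL2 :=
  SchwartzMap.injective_toLp 2 (volume : Measure ℝ)

/-- `XP + PX` as an unbounded operator in `L²(ℝ, ℂ)` whose domain is the Schwartz class. -/
def anticomm : L2 →ₗ.[ℂ] L2 where
  domain := LinearMap.range schwartzToL2
  toFun := schwartzToL2 ∘ₗ schwartzAnticomm ∘ₗ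
    (LinearEquiv.ofInjective schwartzToL2 schwartzToL2_injective).symm.toLinearMap

theorem schwartzToL2_mem_domain (f : 𝓢(ℝ, ℂ)) : schwartzToL2 f ∈ anticomm.domain :=
  ⟨f, rfl⟩

theorem anticomm_apply (f : 𝓢(ℝ, ℂ)) :
    anticomm ⟨schwartzToL2 f, schwartzToL2_mem_domain f⟩ =
      schwartzToL2 (position (momentum f) + momentum (position f)) := by
  have h : (LinearEquiv.ofInjective schwartzToL2 schwartzToL2_injective).symm
      ⟨schwartzToL2 f, schwartzToL2_mem_domain f⟩ = f :=
    (LinearEquiv.symm_apply_eq _).2 rfl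
  change schwartzToL2 (schwartzAnticomm
    ((LinearEquiv.ofInjective schwartzToL2 schwartzToL2_injective).symm
      ⟨schwartzToL2 f, schwartzToL2_mem_domain f⟩)) = _
  rw [h]
  rfl

/-! ### The vacuum vector -/

/-- The Gaussian `x ↦ π^(-1/4) e^(-x²/2)`. -/
def vacuumFun (x : ℝ) : ℂ := ((Real.pi ^ (-(1 / 4) : ℝ) * Real.exp (-x ^ 2 / 2) : ℝ) : ℂ)

theorem memLp_vacuumFun : MemLp vacuumFun 2 (volume : Measure ℝ) := by
  have hc : Continuous vacuumFun := by unfold vacuumFun; fun_prop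
  rw [memLp_two_iff_integrable_sq_norm hc.aestronglyMeasurable]
  have h := (integrable_exp_neg_mul_sq (b := 1) one_pos).const_mul
    ((Real.pi ^ (-(1 / 4) : ℝ)) ^ 2)
  refine h.congr (Eventually.of_forall fun x => ?_)
  simp only [vacuumFun, Complex.norm_real, Real.norm_eq_abs, sq_abs, mul_pow]
  rw [← Real.exp_nat_mul]
  congr 2
  push_cast
  ring

/-- The vacuum vector `Φ`. -/
def vacuum : L2 := memLp_vacuumFun.toLp vacuumFun

/-! ### Spectral resolutions -/

section Spectral

variable {H : Type*} [NormedAddCommGroup H] [InnerProductSpace ℂ H] [CompleteSpace H]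

/-- A resolution of the identity `{E_l | l ∈ ℝ}`: an increasing, strongly right-continuous family
of orthogonal projections which tends strongly to `0` at `-∞` and to the identity at `+∞`. -/
structure ResolutionOfIdentity (H : Type*) [NormedAddCommGroup H] [InnerProductSpace ℂ H]
    [CompleteSpace H] where
  /-- The projection `E_l`. -/
  proj : ℝ → H →L[ℂ] H
  isStarProjection : ∀ l, IsStarProjection (proj l)
  mul_eq_of_le : ∀ l m, l ≤ m → proj l * proj m = proj l
  right_continuous : ∀ (f : H) (l : ℝ),
    ContinuousWithinAt (fun m => proj m f) (Set.Ici l) l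
  tendsto_atBot : ∀ f : H, Tendsto (fun l => proj l f) atBot (𝓝 0)
  tendsto_atTop : ∀ f : H, Tendsto (fun l => proj l f) atTop (𝓝 f)

namespace ResolutionOfIdentity

variable (E : ResolutionOfIdentity H)

theorem inner_proj (l : ℝ) (f : H) : (inner ℂ f (E.proj l f)).re = ‖E.proj l f‖ ^ 2 := by
  have h := E.isStarProjection l
  have h1 : E.proj l (E.proj l f) = E.proj l f := by
    have := h.isIdempotentElem
    exact congrArg (fun A : H →L[ℂ] H => A f) this
  have h2 : inner ℂ (E.proj l f) (E.proj l f) = inner ℂ f (E.proj l (E.proj l f)) := by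
    have hs := h.isSelfAdjoint.isSymmetric
    exact hs f (E.proj l f)
  rw [h1] at h2
  rw [← h2]
  exact inner_self_eq_norm_sq (𝕜 := ℂ) _

theorem inner_proj_mono (f : H) : Monotone fun l => (inner ℂ f (E.proj l f)).re := by
  intro l m hlm
  simp only [inner_proj]
  have h1 : E.proj l (E.proj m f) = E.proj l f :=
    congrArg (fun A : H →L[ℂ] H => A f) (E.mul_eq_of_le l m hlm)
  have h2 : ‖E.proj l (E.proj m f)‖ ^ 2 ≤ ‖E.proj l (E.proj m f)‖ * ‖E.proj m f‖ := by
    rw [← inner_proj]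
    refine (Complex.re_le_norm _).trans ((norm_inner_le_norm _ _).trans ?_)
    rw [mul_comm]
  rw [h1] at h2
  have h3 : ‖E.proj l f‖ ≤ ‖E.proj m f‖ := by
    by_contra! hc
    nlinarith [norm_nonneg (E.proj m f)]
  gcongr

/-- The distribution function `l ↦ ⟨f, E_l f⟩` of the vector `f`. -/
def distribution (f : H) : StieltjesFunction ℝ where
  toFun l := (inner ℂ f (E.proj l f)).re
  mono' := E.inner_proj_mono f
  right_continuous' l := by
    have h : ContinuousWithinAt (fun m => inner ℂ f (E.proj m f)) (Set.Ici l) l :=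
      ContinuousWithinAt.inner continuousWithinAt_const (E.right_continuous f l)
    exact Complex.continuous_re.continuousAt.comp_continuousWithinAt h

/-- The measure `d⟨f, E_l f⟩`. -/
def measure (f : H) : Measure ℝ := (E.distribution f).measure

/-- `A = ∫ φ(l) dE_l`, for a bounded function `φ` and a bounded operator `A`
(which is determined by its quadratic form). -/
def IsIntegral (φ : ℝ → ℂ) (A : H →L[ℂ] H) : Prop :=
  ∀ f : H, inner ℂ f (A f) = ∫ l, φ l ∂E.measure f

/-- `T = ∫ l dE_l`, that is, `E` is the spectral resolution of `T`: the domain of `T` consists of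
the vectors `f` with `∫ l² d⟨f, E_l f⟩ < ∞`, and there `⟨f, T f⟩ = ∫ l d⟨f, E_l f⟩`. -/
def IsResolutionOf (T : H →ₗ.[ℂ] H) : Prop :=
  (∀ f : H, f ∈ T.domain ↔ Integrable (fun l : ℝ => l ^ 2) (E.measure f)) ∧
    ∀ f : T.domain, inner ℂ (f : H) (T f) = ∫ l, (l : ℂ) ∂E.measure (f : H)

/-- `U = e^{itT}`, where `T` has the spectral resolution `E`, that is, `U = ∫ e^{itl} dE_l`. -/
def IsExp (t : ℝ) (U : H →L[ℂ] H) : Prop :=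
  E.IsIntegral (fun l => Complex.exp (Complex.I * t * l)) U

end ResolutionOfIdentity

end Spectral

/-! ### The incomplete Beta function -/

/-- `B(z; a, b) = ∫_0^z w^(a-1) (1-w)^(b-1) dw`, with principal powers, the integral being taken
along the segment `w = z s`, `0 ≤ s ≤ 1`. -/
def incompleteBeta (z a b : ℂ) : ℂ :=
  ∫ s in (0 : ℝ)..1, (z * s) ^ (a - 1) * (1 - z * s) ^ (b - 1) * z

/-- `e^(-πt/4) B(-1; (1-it)/4, 1/2) + e^(πt/4) B(-1; (1+it)/4, 1/2)`. -/
def betaCombination (t : ℝ) : ℂ :=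
  Real.exp (-(Real.pi * t) / 4) * incompleteBeta (-1) ((1 - Complex.I * t) / 4) (1 / 2) +
    Real.exp (Real.pi * t / 4) * incompleteBeta (-1) ((1 + Complex.I * t) / 4) (1 / 2)

end Anticommutator

end

/-!
The operator `XP + PX = -i(2x d/dx + 1)` generates the dilations `f ↦ e^t f(e^{2t} x)`, and the
proof never leaves this flow.

*Every self-adjoint extension.* Let `T ⊇ XP + PX` be self-adjoint with resolution `E`. The dilated
Gaussians `u(t)(x) = e^t Φ(e^{2t} x)` are Schwartz functions, so they lie in the domain of `T`, and
they solve `u' = iTu` in `L²` (`hasDerivAt_flow`). The abstract part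
(`IsResolutionOf.inner_eq_integral_exp`) shows that any solution satisfies
`⟨u(0), u(t)⟩ = ∫ e^{itl} d⟨u(0), E_l u(0)⟩`. It needs no functional calculus: polarizing the
quadratic form shows that the projections `E_l` commute with `T`, so `T` is within `b - a` of the
constant `a` on the range of `E_b - E_a`, and there `u(t)` is close to `e^{iat} u(0)`; hence the
defect of the formula, cut off at the spectral value `l`, has right derivative zero in `l`. As `⟨Φ, u(t)⟩` is a Gaussian integral, equal to `(sech 2t)^(1/2)`
(`inner_flow`), the characteristic function of the spectral measure of `Φ` is known for every
extension; essential self-adjointness is not used.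

*The density.* The function `(sech 2t)^(1/2)` has two integrable derivatives, so its Fourier
transform is integrable, and Fourier inversion together with the uniqueness theorem for
characteristic functions identifies the spectral measure (`real_Iic_eq_integral_of_charFun`). The
substitution `s = e^{-4x}` on each half-line turns the Fourier integral into the two incomplete
Beta functions (`vacuumDensity_eq_betaCombination`).

*Existence.* In the coordinates `x = ±e^y`, that is, for the functions
`e^{y/2} (f(e^y), f(-e^y)) ∈ L²(ℝ, ℂ²)`, the operator `XP + PX` becomes `-2i d/dy`, and the Fourier
transform makes it multiplication by `4πξ` (`mellinEquiv_anticomm`). Multiplication by a real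
function is self-adjoint on its maximal domain, and its resolution is given by the indicators of
sublevel sets.

*The power series* of `B(z; a, b)` is the binomial series of `(1 - w)^(b-1)` integrated term by
term; on `‖z‖ = 1` the sum of the norms converges because it telescopes
(`summable_norm_betaCoeff_div`).
-/

namespace Anticommutator

open scoped FourierTransform ContDiff

/-! ### Exponentials on the line -/

theorem norm_exp_sub_exp_le (t x y : ℝ) :
    ‖Complex.exp (Complex.I * t * x) - Complex.exp (Complex.I * t * y)‖ ≤ |t| * |x - y| := by
  have h : Complex.exp (Complex.I * t * x) - Complex.exp (Complex.I * t * y) =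
      Complex.exp ((t * y : ℝ) * Complex.I) * (Complex.exp (Complex.I * (t * (x - y) : ℝ)) - 1) := by
    rw [mul_sub, ← Complex.exp_add, mul_one]
    congr 2 <;> · push_cast; ring
  rw [h, norm_mul, Complex.norm_exp_ofReal_mul_I, one_mul, ← abs_mul]
  exact Real.norm_exp_I_mul_ofReal_sub_one_le

theorem continuous_exp_I_mul (t : ℝ) : Continuous fun l : ℝ => Complex.exp (Complex.I * t * l) := by
  fun_prop

theorem norm_exp_I_mul (t l : ℝ) : ‖Complex.exp (Complex.I * t * l)‖ = 1 := by
  have : Complex.I * t * l = (t * l : ℝ) * Complex.I := by push_cast; ring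
  rw [this, Complex.norm_exp_ofReal_mul_I]

theorem integrable_exp_I_mul (t : ℝ) (μ : Measure ℝ) [IsFiniteMeasure μ] :
    Integrable (fun l : ℝ => Complex.exp (Complex.I * t * l)) μ :=
  Integrable.of_bound (C := 1) (continuous_exp_I_mul t).aestronglyMeasurable
    (Eventually.of_forall fun l => (norm_exp_I_mul t l).le)

/-! ### Spectral projections and the operator they resolve -/

namespace ResolutionOfIdentity

variable {H : Type*} [NormedAddCommGroup H] [InnerProductSpace ℂ H] [CompleteSpace H]
  (E : ResolutionOfIdentity H)

theorem proj_proj_of_le {l m : ℝ} (h : l ≤ m) (f : H) : E.proj l (E.proj m f) = E.proj l f :=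
  congrArg (fun A : H →L[ℂ] H => A f) (E.mul_eq_of_le l m h)

theorem inner_proj_left (l : ℝ) (f g : H) : inner ℂ (E.proj l f) g = inner ℂ f (E.proj l g) :=
  (E.isStarProjection l).isSelfAdjoint.isSymmetric f g

theorem proj_proj_of_ge {l m : ℝ} (h : m ≤ l) (f : H) : E.proj l (E.proj m f) = E.proj m f := by
  refine ext_inner_right ℂ fun g => ?_
  rw [inner_proj_left, inner_proj_left, proj_proj_of_le E h, ← inner_proj_left]

theorem proj_comm (l m : ℝ) (f : H) : E.proj l (E.proj m f) = E.proj m (E.proj l f) := by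
  rcases le_total l m with h | h
  · rw [proj_proj_of_le E h, proj_proj_of_ge E h]
  · rw [proj_proj_of_ge E h, proj_proj_of_le E h]

theorem proj_proj_self (l : ℝ) (f : H) : E.proj l (E.proj l f) = E.proj l f :=
  proj_proj_of_le E le_rfl f

theorem distribution_apply (f : H) (l : ℝ) : E.distribution f l = ‖E.proj l f‖ ^ 2 :=
  E.inner_proj l f

theorem inner_self_proj (l : ℝ) (f : H) :
    inner ℂ f (E.proj l f) = ((‖E.proj l f‖ ^ 2 : ℝ) : ℂ) := by
  rw [← proj_proj_self, ← inner_proj_left, inner_self_eq_norm_sq_to_K, proj_proj_self]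
  simp

theorem measure_Iic (f : H) (l : ℝ) :
    E.measure f (Set.Iic l) = ENNReal.ofReal (‖E.proj l f‖ ^ 2) := by
  have h : Tendsto (E.distribution f) atBot (𝓝 0) := by
    have h1 := ((E.tendsto_atBot f).norm).pow 2
    simp only [norm_zero, ne_eq, OfNat.ofNat_ne_zero, not_false_eq_true, zero_pow] at h1
    exact h1.congr fun l => (E.distribution_apply f l).symm
  rw [measure, StieltjesFunction.measure_Iic _ h, sub_zero, distribution_apply]

theorem measure_univ (f : H) : E.measure f Set.univ = ENNReal.ofReal (‖f‖ ^ 2) := by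
  have h : Tendsto (E.distribution f) atBot (𝓝 0) := by
    have h1 := ((E.tendsto_atBot f).norm).pow 2
    simp only [norm_zero, ne_eq, OfNat.ofNat_ne_zero, not_false_eq_true, zero_pow] at h1
    exact h1.congr fun l => (E.distribution_apply f l).symm
  have h' : Tendsto (E.distribution f) atTop (𝓝 (‖f‖ ^ 2)) :=
    (((E.tendsto_atTop f).norm).pow 2).congr fun l => (E.distribution_apply f l).symm
  rw [measure, StieltjesFunction.measure_univ _ h h', sub_zero]

instance isFiniteMeasure_measure (f : H) : IsFiniteMeasure (E.measure f) :=
  ⟨by rw [measure_univ]; exact ENNReal.ofReal_lt_top⟩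

/-- The measure of a vector splits along a spectral projection, since all the `E_l` commute. -/
theorem measure_eq_add (l : ℝ) (f : H) :
    E.measure f = E.measure (E.proj l f) + E.measure (f - E.proj l f) := by
  refine Measure.ext_of_Iic _ _ fun m => ?_
  rw [Measure.add_apply, measure_Iic, measure_Iic, measure_Iic,
    ← ENNReal.ofReal_add (by positivity) (by positivity)]
  congr 1
  have h : inner ℂ (E.proj m (E.proj l f)) (E.proj m (f - E.proj l f)) = 0 := by
    rw [inner_proj_left, proj_proj_self, inner_proj_left, map_sub, map_sub, proj_comm E l m,
      proj_comm E l m (E.proj l f), proj_proj_self, sub_self, inner_zero_right]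
  have h2 := norm_add_sq_eq_norm_sq_add_norm_sq_of_inner_eq_zero _ _ h
  rw [← map_add, add_sub_cancel] at h2
  simpa [sq] using h2

/-- The spectral projection `E_b - E_a` of the interval `(a, b]`. -/
noncomputable def window (a b : ℝ) : H →L[ℂ] H := E.proj b - E.proj a

theorem window_apply (a b : ℝ) (f : H) : E.window a b f = E.proj b f - E.proj a f := rfl

theorem window_window {a b : ℝ} (h : a ≤ b) (f : H) :
    E.window a b (E.window a b f) = E.window a b f := by
  simp [window_apply, proj_proj_self, proj_proj_of_le E h, proj_proj_of_ge E h]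

theorem inner_window_left (a b : ℝ) (f g : H) :
    inner ℂ (E.window a b f) g = inner ℂ f (E.window a b g) := by
  rw [window_apply, window_apply, inner_sub_left, inner_sub_right, inner_proj_left, inner_proj_left]

theorem inner_self_window {a b : ℝ} (h : a ≤ b) (f : H) :
    inner ℂ f (E.window a b f) = ((‖E.window a b f‖ ^ 2 : ℝ) : ℂ) := by
  rw [← window_window E h, ← inner_window_left, inner_self_eq_norm_sq_to_K, window_window E h]
  simp

theorem norm_window_sq {a b : ℝ} (h : a ≤ b) (f : H) :
    ‖E.window a b f‖ ^ 2 = E.distribution f b - E.distribution f a := by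
  have h1 := inner_self_window E h f
  rw [window_apply, inner_sub_right, inner_self_proj, inner_self_proj, ← Complex.ofReal_sub] at h1
  rw [distribution_apply, distribution_apply, Complex.ofReal_injective h1]
  rfl

theorem measure_Ioc {a b : ℝ} (h : a ≤ b) (f : H) :
    E.measure f (Set.Ioc a b) = ENNReal.ofReal (‖E.window a b f‖ ^ 2) := by
  rw [measure, StieltjesFunction.measure_Ioc, norm_window_sq E h]

theorem ae_mem_Ioc {a b : ℝ} (h : a ≤ b) {f : H} (hf : E.window a b f = f) :
    ∀ᵐ l ∂E.measure f, l ∈ Set.Ioc a b := by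
  have h1 : E.measure f (Set.Ioc a b) = E.measure f Set.univ := by
    rw [measure_Ioc E h, hf, measure_univ]
  exact (ae_iff_measure_eq measurableSet_Ioc.nullMeasurableSet).2 h1

variable {E} {T : H →ₗ.[ℂ] H}

namespace IsResolutionOf

variable (hE : E.IsResolutionOf T)
include hE

theorem integrable_id {f : H} (hf : f ∈ T.domain) : Integrable (fun l : ℝ => (l : ℂ)) (E.measure f) := by
  have h : MemLp (fun l : ℝ => l) 2 (E.measure f) :=
    (memLp_two_iff_integrable_sq (by fun_prop)).2 ((hE.1 f).1 hf)
  exact (h.integrable (by norm_num)).ofReal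

theorem proj_mem (l : ℝ) {f : H} (hf : f ∈ T.domain) : E.proj l f ∈ T.domain := by
  refine (hE.1 _).2 (((hE.1 f).1 hf).mono_measure ?_)
  rw [E.measure_eq_add l f]
  exact Measure.le_add_right le_rfl

theorem sub_proj_mem (l : ℝ) {f : H} (hf : f ∈ T.domain) : f - E.proj l f ∈ T.domain :=
  T.domain.sub_mem hf (hE.proj_mem l hf)

theorem quadratic_split (l : ℝ) {f : H} (hf : f ∈ T.domain) :
    inner ℂ f (T ⟨f, hf⟩) = inner ℂ (E.proj l f) (T ⟨E.proj l f, hE.proj_mem l hf⟩) +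
      inner ℂ (f - E.proj l f) (T ⟨f - E.proj l f, hE.sub_proj_mem l hf⟩) := by
  have h1 := hE.2 ⟨f, hf⟩
  have h2 := hE.2 ⟨_, hE.proj_mem l hf⟩
  have h3 := hE.2 ⟨_, hE.sub_proj_mem l hf⟩
  dsimp only at h1 h2 h3
  rw [h1, h2, h3, E.measure_eq_add l f, integral_add_measure]
  · exact hE.integrable_id (hE.proj_mem l hf)
  · exact hE.integrable_id (hE.sub_proj_mem l hf)

/-- `T` has no off-diagonal part with respect to `E_l`: the quadratic form of `T` splits along
`E_l`, and polarization gives the sesquilinear form. -/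
theorem off_diagonal (l : ℝ) {g h : H} (hg : g ∈ T.domain) (hh : h ∈ T.domain) :
    inner ℂ (E.proj l g) (T ⟨h - E.proj l h, hE.sub_proj_mem l hh⟩) = 0 ∧
      inner ℂ (h - E.proj l h) (T ⟨E.proj l g, hE.proj_mem l hg⟩) = 0 := by
  set x : T.domain := ⟨E.proj l g, hE.proj_mem l hg⟩ with hx
  set y : T.domain := ⟨h - E.proj l h, hE.sub_proj_mem l hh⟩ with hy
  have hPx : E.proj l (x : H) = x := E.proj_proj_self l g
  have hPy : E.proj l (y : H) = 0 := by
    simp [hy, E.proj_proj_self l h]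
  have key : ∀ c : ℂ, inner ℂ (c • (x : H)) (T y) + inner ℂ (y : H) (T (c • x)) = 0 := by
    intro c
    have h1 := hE.quadratic_split l (c • x + y).2
    have h2 : E.proj l ((c • x + y : T.domain) : H) = (c • x : T.domain) := by
      simp [hPx, hPy]
    have h3 : ((c • x + y : T.domain) : H) - E.proj l ((c • x + y : T.domain) : H) = y := by
      rw [h2]; simp
    have h4 : (⟨E.proj l ((c • x + y : T.domain) : H), hE.proj_mem l (c • x + y).2⟩ : T.domain)
        = c • x := Subtype.ext h2
    have h5 : (⟨((c • x + y : T.domain) : H) - E.proj l ((c • x + y : T.domain) : H),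
        hE.sub_proj_mem l (c • x + y).2⟩ : T.domain) = y := Subtype.ext h3
    rw [h4, h5, h3, h2, Subtype.coe_eta, T.map_add] at h1
    simp only [Submodule.coe_add, inner_add_left, inner_add_right] at h1
    have h6 : ((c • x : T.domain) : H) = c • (x : H) := rfl
    rw [h6] at h1
    linear_combination h1
  have k1 := key 1
  have k2 := key Complex.I
  rw [one_smul, one_smul] at k1
  rw [T.map_smul, inner_smul_left, inner_smul_right, Complex.conj_I] at k2
  have e1 : inner ℂ (x : H) (T y) = 0 := by
    have : (2 : ℂ) * inner ℂ (x : H) (T y) = 0 := by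
      linear_combination k1 + Complex.I * k2 - (inner ℂ (y : H) (T x) - inner ℂ (x : H) (T y)) * Complex.I_sq
    simpa using this
  refine ⟨e1, ?_⟩
  rwa [e1, zero_add] at k1

/-- The spectral projections commute with `T`. -/
theorem map_proj (hT : Dense (T.domain : Set H)) (l : ℝ) {f : H} (hf : f ∈ T.domain) :
    T ⟨E.proj l f, hE.proj_mem l hf⟩ = E.proj l (T ⟨f, hf⟩) := by
  set x : T.domain := ⟨E.proj l f, hE.proj_mem l hf⟩ with hx
  set y : T.domain := ⟨f - E.proj l f, hE.sub_proj_mem l hf⟩ with hy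
  have hxy : (⟨f, hf⟩ : T.domain) = x + y := Subtype.ext (by simp [hx, hy])
  have h1 : E.proj l (T y) = 0 := by
    refine hT.eq_zero_of_inner_right ℂ (fun g hg => ?_)
    rw [← E.inner_proj_left]
    exact (hE.off_diagonal l hg hf).1
  have h2 : T x - E.proj l (T x) = 0 := by
    refine hT.eq_zero_of_inner_right ℂ (fun g hg => ?_)
    rw [inner_sub_right, ← E.inner_proj_left, ← inner_sub_left]
    exact (hE.off_diagonal l hf hg).2
  rw [hxy, T.map_add, map_add, h1, add_zero]
  exact sub_eq_zero.1 h2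

theorem window_mem {a b : ℝ} (h : a ≤ b) (f : H) : E.window a b f ∈ T.domain := by
  refine (hE.1 _).2 ?_
  refine Integrable.of_bound (C := (max |a| |b|) ^ 2) (by fun_prop) ?_
  filter_upwards [E.ae_mem_Ioc h (E.window_window h f)] with l hl
  rw [Real.norm_eq_abs, abs_pow]
  gcongr
  exact abs_le_max_abs_abs hl.1.le hl.2

theorem map_window (hT : Dense (T.domain : Set H)) {a b : ℝ} (h : a ≤ b) {f : H}
    (hf : f ∈ T.domain) : T ⟨E.window a b f, hE.window_mem h f⟩ = E.window a b (T ⟨f, hf⟩) := by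
  rw [E.window_apply a b (T ⟨f, hf⟩), ← hE.map_proj hT b hf, ← hE.map_proj hT a hf, ← T.map_sub]
  rfl

theorem norm_inner_sub_le {a b : ℝ} (h : a ≤ b) {z : H} (hz : E.window a b z = z)
    (hz' : z ∈ T.domain) :
    ‖inner ℂ z (T ⟨z, hz'⟩ - (a : ℂ) • z)‖ ≤ (b - a) * ‖z‖ ^ 2 := by
  have h1 := hE.2 ⟨z, hz'⟩
  have hreal : (E.measure z).real Set.univ = ‖z‖ ^ 2 := by
    rw [Measure.real, E.measure_univ, ENNReal.toReal_ofReal (by positivity)]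
  have h2 : inner ℂ z ((a : ℂ) • z) = ∫ _, (a : ℂ) ∂E.measure z := by
    rw [integral_const, hreal, inner_smul_right, inner_self_eq_norm_sq_to_K, mul_comm]
    simp
  dsimp only at h1
  rw [inner_sub_right, h1, h2, ← integral_sub (hE.integrable_id hz') (integrable_const _)]
  rw [← hreal]
  refine norm_integral_le_of_norm_le_const ?_
  filter_upwards [E.ae_mem_Ioc h hz] with l hl
  rw [← Complex.ofReal_sub, Complex.norm_real, Real.norm_eq_abs, abs_of_pos (sub_pos.2 hl.1)]
  linarith [hl.2]

/-- On the range of the spectral projection of `(a, b]` the operator `T` differs from the constant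
`a` by at most `b - a` in norm. -/
theorem norm_sub_le (hT : IsSelfAdjoint T) {a b : ℝ} (h : a < b) {z : H}
    (hz : E.window a b z = z) (hz' : z ∈ T.domain) :
    ‖T ⟨z, hz'⟩ - (a : ℂ) • z‖ ≤ (b - a) * ‖z‖ := by
  have hd := hT.dense_domain
  have hsymm : ∀ x y : T.domain, inner ℂ (T x) (y : H) = inner ℂ (x : H) (T y) := by
    have := LinearPMap.adjoint_isFormalAdjoint (T := T) hd
    rw [LinearPMap.isSelfAdjoint_def.1 hT] at this
    exact fun x y => this x y
  set d := b - a with hdd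
  have hd0 : 0 < d := sub_pos.2 h
  set w := T ⟨z, hz'⟩ - (a : ℂ) • z with hw
  have hPw : E.window a b w = w := by
    rw [hw, map_sub, map_smul, hz, ← hE.map_window hd h.le hz']
    simp only [hz]
  -- Polarizing between `z` and `v = d⁻¹ w` gives `4 d⁻¹ ‖w‖²` on the left of the form bound; the
  -- factor `d⁻¹` makes the right side, `2 d (‖z‖² + ‖v‖²)`, absorb half of it.
  set v : H := ((d⁻¹ : ℝ) : ℂ) • w with hv
  have hPv : E.window a b v = v := by rw [hv, map_smul, hPw]
  have hv' : v ∈ T.domain := by rw [← hPv]; exact hE.window_mem h.le v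
  set Z : T.domain := ⟨z, hz'⟩
  set V : T.domain := ⟨v, hv'⟩
  have hp := hE.norm_inner_sub_le h.le (z := z + v) (by rw [map_add, hz, hPv]) (Z + V).2
  have hm := hE.norm_inner_sub_le h.le (z := z - v) (by rw [map_sub, hz, hPv]) (Z - V).2
  have hpar := parallelogram_law_with_norm ℂ z v
  have hsub := _root_.norm_sub_le (inner ℂ (z + v) (T (Z + V) - (a : ℂ) • (z + v)))
    (inner ℂ (z - v) (T (Z - V) - (a : ℂ) • (z - v)))
  have hsz := hsymm V Z
  have hsv := hsymm Z V
  have hid : inner ℂ (z + v) (T (Z + V) - (a : ℂ) • (z + v)) -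
      inner ℂ (z - v) (T (Z - V) - (a : ℂ) • (z - v)) =
      ((4 * d⁻¹ * ‖w‖ ^ 2 : ℝ) : ℂ) := by
    have e1 : inner ℂ v (T Z - (a : ℂ) • z) = ((d⁻¹ * ‖w‖ ^ 2 : ℝ) : ℂ) := by
      change inner ℂ v w = _
      rw [hv, inner_smul_left, inner_self_eq_norm_sq_to_K]
      simp
    have e2 : inner ℂ z (T V - (a : ℂ) • v) = ((d⁻¹ * ‖w‖ ^ 2 : ℝ) : ℂ) := by
      have : inner ℂ z (T V - (a : ℂ) • v) = inner ℂ w v := by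
        rw [inner_sub_right, hw, inner_sub_left, inner_smul_left, inner_smul_right,
          Complex.conj_ofReal]
        congr 1
        exact hsv.symm
      rw [this, hv, inner_smul_right, inner_self_eq_norm_sq_to_K]
      simp
    rw [T.map_add, T.map_sub]
    simp only [inner_add_left, inner_sub_left, inner_add_right, inner_sub_right, smul_add,
      smul_sub] at e1 e2 ⊢
    push_cast at e1 e2 ⊢
    linear_combination 2 * e1 + 2 * e2
  rw [hid, Complex.norm_real, Real.norm_eq_abs, abs_of_nonneg (by positivity)] at hsub
  have hvn : ‖v‖ = d⁻¹ * ‖w‖ := by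
    rw [hv, norm_smul, Complex.norm_real, Real.norm_eq_abs, abs_of_pos (by positivity)]
  have hfin : 4 * d⁻¹ * ‖w‖ ^ 2 ≤ d * (2 * (‖z‖ ^ 2 + ‖v‖ ^ 2)) := by
    refine hsub.trans ((add_le_add hp hm).trans ?_)
    nlinarith
  rw [hvn] at hfin
  have h3 : ‖w‖ ^ 2 ≤ (d * ‖z‖) ^ 2 := by
    have e : d * (2 * (‖z‖ ^ 2 + (d⁻¹ * ‖w‖) ^ 2)) = 2 * d * ‖z‖ ^ 2 + 2 * d⁻¹ * ‖w‖ ^ 2 := by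
      field_simp
    rw [e] at hfin
    have h4 : d⁻¹ * ‖w‖ ^ 2 ≤ d * ‖z‖ ^ 2 := by linarith
    rw [inv_mul_le_iff₀ hd0] at h4
    linarith
  exact le_of_sq_le_sq h3 (by positivity)

/-! ### Solutions of `u' = iTu` -/

variable {u : ℝ → T.domain}

theorem im_inner_self_eq_zero {f : H} (hf : f ∈ T.domain) :
    (inner ℂ f (T ⟨f, hf⟩)).im = 0 := by
  rw [hE.2 ⟨f, hf⟩, integral_complex_ofReal, Complex.ofReal_im]

/-- Within the spectral interval `(a, b]`, a solution of `u' = iTu` rotates like `e^{iat}`, up to an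
error of order `b - a`. -/
theorem norm_window_sub_le (hT : IsSelfAdjoint T)
    (hu : ∀ t, HasDerivAt (fun s => (u s : H)) (Complex.I • T (u t)) t) {a b : ℝ} (h : a < b)
    (t : ℝ) :
    ‖E.window a b (u t) - Complex.exp (Complex.I * t * a) • E.window a b (u 0)‖ ≤
      (b - a) * ‖E.window a b (u 0)‖ * |t| := by
  set P := E.window a b with hP
  have hmem : ∀ t, P (u t) ∈ T.domain := fun t => hE.window_mem h.le _
  have hv : ∀ t, HasDerivAt (fun s => P (u s)) (Complex.I • T ⟨P (u t), hmem t⟩) t := by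
    intro t
    rw [hE.map_window hT.dense_domain h.le (u t).2, ← map_smul]
    exact (P.restrictScalars ℝ).hasFDerivAt.comp_hasDerivAt t (hu t)
  have hnorm : ∀ t, ‖P (u t)‖ = ‖P (u 0)‖ := by
    have hd : ∀ t, HasDerivAt (fun s => ‖P (u s)‖ ^ 2) 0 t := by
      intro t
      have h1 := ((hv t).inner ℂ (hv t))
      have h2 := Complex.reCLM.hasFDerivAt.comp_hasDerivAt t h1
      have e0 : (fun s => ‖P (u s)‖ ^ 2) =
          Complex.reCLM ∘ fun s => inner ℂ (P (u s)) (P (u s)) := by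
        funext s
        exact (inner_self_eq_norm_sq (𝕜 := ℂ) (P (u s))).symm
      rw [e0]
      convert! h2 using 1
      have e1 := hE.im_inner_self_eq_zero (hmem t)
      rw [inner_smul_right, inner_smul_left, ← inner_conj_symm (T _) (P (u t))]
      simp [-inner_conj_symm, e1]
    intro t
    have := is_const_of_deriv_eq_zero (fun t => (hd t).differentiableAt)
      (fun t => (hd t).deriv) t 0
    exact (sq_eq_sq₀ (norm_nonneg _) (norm_nonneg _)).1 this
  set w : ℝ → H := fun s => Complex.exp (-(Complex.I * s * a)) • P (u s) with hw
  have hwd : ∀ t : ℝ, HasDerivAt w (Complex.exp (-(Complex.I * t * a)) •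
      (Complex.I • (T ⟨P (u t), hmem t⟩ - (a : ℂ) • P (u t)))) t := by
    intro t
    have h1 : HasDerivAt (fun s : ℝ => Complex.exp (-(Complex.I * s * a)))
        (Complex.exp (-(Complex.I * t * a)) * -(Complex.I * 1 * a)) t := by
      refine HasDerivAt.cexp ?_
      exact (((Complex.ofRealCLM.hasDerivAt (x := t)).const_mul Complex.I).mul_const (a : ℂ)).neg
    convert! h1.smul (hv t) using 1
    module
  have hbound := Convex.norm_image_sub_le_of_norm_hasDerivWithin_le (s := Set.univ) (f := w)
    (C := (b - a) * ‖P (u 0)‖) (x := 0) (y := t) (fun t _ => (hwd t).hasDerivWithinAt)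
    (fun t _ => by
      have e : -(Complex.I * t * a) = Complex.I * (-t : ℝ) * a := by push_cast; ring
      rw [norm_smul, norm_smul, e, norm_exp_I_mul, Complex.norm_I, one_mul, one_mul, ← hnorm t]
      exact hE.norm_sub_le hT h (E.window_window h.le _) (hmem t))
    convex_univ trivial trivial
  have e2 : w t - w 0 = Complex.exp (-(Complex.I * t * a)) •
      (P (u t) - Complex.exp (Complex.I * t * a) • P (u 0)) := by
    rw [smul_sub, smul_smul, ← Complex.exp_add]
    simp [hw]
  have e : -(Complex.I * t * a) = Complex.I * (-t : ℝ) * a := by push_cast; ring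
  rw [e2, norm_smul, e, norm_exp_I_mul, one_mul, sub_zero] at hbound
  simpa [Real.norm_eq_abs] using hbound

theorem norm_inner_window_sub_le (hT : IsSelfAdjoint T)
    (hu : ∀ t, HasDerivAt (fun s => (u s : H)) (Complex.I • T (u t)) t) {a b : ℝ} (h : a < b)
    (t : ℝ) :
    ‖inner ℂ (u 0 : H) (E.window a b (u t)) -
        ∫ l in Set.Ioc a b, Complex.exp (Complex.I * t * l) ∂E.measure (u 0 : H)‖ ≤
      2 * |t| * (b - a) * (E.distribution (u 0 : H) b - E.distribution (u 0 : H) a) := by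
  set P := E.window a b with hP
  set μ := E.measure (u 0 : H) with hμ
  have hm : μ.real (Set.Ioc a b) = ‖P (u 0)‖ ^ 2 := by
    rw [Measure.real, hμ, E.measure_Ioc h.le, ENNReal.toReal_ofReal (by positivity)]
  have h1 : ‖inner ℂ (u 0 : H) (P (u t)) - Complex.exp (Complex.I * t * a) * (‖P (u 0)‖ ^ 2 : ℝ)‖ ≤
      (b - a) * |t| * ‖P (u 0)‖ ^ 2 := by
    have e : inner ℂ (u 0 : H) (P (u t)) - Complex.exp (Complex.I * t * a) * (‖P (u 0)‖ ^ 2 : ℝ) =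
        inner ℂ (P (u 0)) (P (u t) - Complex.exp (Complex.I * t * a) • P (u 0)) := by
      rw [inner_sub_right, inner_smul_right, inner_self_eq_norm_sq_to_K, hP, E.inner_window_left,
        E.window_window h.le]
      simp
    rw [e]
    refine (norm_inner_le_norm _ _).trans ?_
    refine (mul_le_mul_of_nonneg_left (hE.norm_window_sub_le hT hu h t) (norm_nonneg _)).trans ?_
    rw [← hP]
    exact le_of_eq (by ring)
  have h2 : ‖(∫ l in Set.Ioc a b, Complex.exp (Complex.I * t * l) ∂μ) -
      Complex.exp (Complex.I * t * a) * (‖P (u 0)‖ ^ 2 : ℝ)‖ ≤ |t| * (b - a) * ‖P (u 0)‖ ^ 2 := by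
    have e : Complex.exp (Complex.I * t * a) * (‖P (u 0)‖ ^ 2 : ℝ) =
        ∫ _ in Set.Ioc a b, Complex.exp (Complex.I * t * a) ∂μ := by
      rw [setIntegral_const, hm, Complex.real_smul, mul_comm]
    rw [e, ← integral_sub (integrable_exp_I_mul t μ).integrableOn (integrable_const _), ← hm]
    refine norm_setIntegral_le_of_norm_le_const (measure_lt_top _ _) fun l hl => ?_
    refine (norm_exp_sub_exp_le t l a).trans ?_
    rw [abs_of_pos (sub_pos.2 hl.1)]
    gcongr
    exact hl.2
  rw [← E.norm_window_sq h.le, ← hP]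
  calc _ ≤ _ := norm_sub_le_norm_sub_add_norm_sub _
        (Complex.exp (Complex.I * t * a) * (‖P (u 0)‖ ^ 2 : ℝ)) _
    _ ≤ _ := by rw [norm_sub_rev _ (∫ l in Set.Ioc a b, _ ∂μ)]; linarith

/-- If `u' = iTu`, then `⟨u(0), u(t)⟩` is the characteristic function of the spectral measure of
`u(0)`. The difference of the two sides, cut off at the spectral value `l`, changes by
`O((b - a) (F(b) - F(a)))` between `a` and `b`, where `F` is the distribution function; as `F` is
right-continuous, its right derivative in `l` vanishes, so it is constant. -/
theorem inner_eq_integral_exp (hT : IsSelfAdjoint T)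
    (hu : ∀ t, HasDerivAt (fun s => (u s : H)) (Complex.I • T (u t)) t) (t : ℝ) :
    inner ℂ (u 0 : H) (u t : H) =
      ∫ l, Complex.exp (Complex.I * t * l) ∂E.measure (u 0 : H) := by
  set μ := E.measure (u 0 : H) with hμ
  set F := E.distribution (u 0 : H) with hF
  set G : ℝ → ℂ := fun l => inner ℂ (u 0 : H) (E.proj l (u t)) -
    ∫ x in Set.Iic l, Complex.exp (Complex.I * t * x) ∂μ with hG
  have hint := integrable_exp_I_mul t μ
  have hstep : ∀ a b, a ≤ b → ‖G b - G a‖ ≤ 2 * |t| * (b - a) * (F b - F a) := by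
    intro a b hab
    rcases hab.eq_or_lt with rfl | hab
    · simp
    have e : G b - G a = inner ℂ (u 0 : H) (E.window a b (u t)) -
        ∫ l in Set.Ioc a b, Complex.exp (Complex.I * t * l) ∂μ := by
      have hs : Set.Iic b \ Set.Iic a = Set.Ioc a b := by ext; simp [and_comm]
      rw [← hs, setIntegral_sdiff measurableSet_Iic hint.integrableOn (Set.Iic_subset_Iic.2 hab.le),
        E.window_apply, inner_sub_right]
      simp only [hG]
      ring
    rw [e]
    exact hE.norm_inner_window_sub_le hT hu hab t
  have hderiv : ∀ a, HasDerivWithinAt G 0 (Set.Ici a) a := by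
    intro a
    rw [hasDerivWithinAt_iff_isLittleO, Asymptotics.isLittleO_iff]
    intro c hc
    have h1 : Tendsto (fun b => 2 * |t| * (F b - F a)) (𝓝[≥] a) (𝓝 0) := by
      have := ((F.right_continuous a).tendsto.sub_const (F a)).const_mul (2 * |t|)
      simpa using this
    filter_upwards [h1.eventually (gt_mem_nhds hc), self_mem_nhdsWithin] with b hb hab
    have hab' : a ≤ b := hab
    rw [smul_zero, sub_zero, Real.norm_eq_abs, abs_of_nonneg (sub_nonneg.2 hab')]
    refine (hstep a b hab').trans ?_
    calc _ = 2 * |t| * (F b - F a) * (b - a) := by ring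
      _ ≤ _ := mul_le_mul_of_nonneg_right hb.le (sub_nonneg.2 hab')
  have hcont : Continuous G := by
    have hFb : ∀ a b, F b - F a ≤ ‖(u 0 : H)‖ ^ 2 := by
      intro a b
      have h1 : F b ≤ ‖(u 0 : H)‖ ^ 2 := by
        rw [hF, E.distribution_apply]
        have := measure_mono (μ := μ) (Set.subset_univ (Set.Iic b))
        rw [hμ, E.measure_Iic, E.measure_univ] at this
        exact (ENNReal.ofReal_le_ofReal_iff (by positivity)).1 this
      have h2 : 0 ≤ F a := by rw [hF, E.distribution_apply]; positivity
      linarith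
    have hle : ∀ a b, a ≤ b → dist (G a) (G b) ≤ 2 * |t| * ‖(u 0 : H)‖ ^ 2 * dist a b := by
      intro a b hab
      rw [dist_comm, dist_eq_norm, dist_comm, Real.dist_eq, abs_of_nonneg (sub_nonneg.2 hab)]
      refine (hstep a b hab).trans ?_
      calc _ ≤ 2 * |t| * (b - a) * ‖(u 0 : H)‖ ^ 2 :=
            mul_le_mul_of_nonneg_left (hFb a b)
              (mul_nonneg (by positivity) (sub_nonneg.2 hab))
        _ = _ := by ring
    refine (LipschitzWith.of_dist_le_mul (K := ⟨2 * |t| * ‖(u 0 : H)‖ ^ 2, by positivity⟩)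
      fun a b => ?_).continuous
    rcases le_total a b with h | h
    · exact hle a b h
    · rw [dist_comm, dist_comm a]; exact hle b a h
  have hconst : ∀ a b, a ≤ b → G b = G a := fun a b hab =>
    constant_of_has_deriv_right_zero hcont.continuousOn (fun x _ => hderiv x) b ⟨hab, le_rfl⟩
  have hbot : Tendsto G atBot (𝓝 0) := by
    have h1 : Tendsto (fun l => inner ℂ (u 0 : H) (E.proj l (u t))) atBot (𝓝 0) := by
      simpa using (tendsto_const_nhds (x := (u 0 : H))).inner (𝕜 := ℂ) (E.tendsto_atBot (u t))
    have h2 := tendsto_setIntegral_of_antitone (μ := μ) (f := fun x : ℝ =>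
      Complex.exp (Complex.I * t * x)) (s := fun l : ℝᵒᵈ => Set.Iic (OrderDual.ofDual l))
      (fun _ => measurableSet_Iic) (fun a b h => Set.Iic_subset_Iic.2 h) ⟨0, hint.integrableOn⟩
    have h3 : (⋂ n : ℝᵒᵈ, Set.Iic (OrderDual.ofDual n)) = ∅ := by
      refine Set.eq_empty_iff_forall_notMem.2 fun x hx => ?_
      have := Set.mem_iInter.1 hx (OrderDual.toDual (x - 1))
      simp at this
      linarith
    rw [h3, setIntegral_empty] at h2
    have h4 : Tendsto (fun l : ℝ => ∫ x in Set.Iic l, Complex.exp (Complex.I * t * x) ∂μ)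
        atBot (𝓝 0) := h2
    have h5 := h1.sub h4
    rw [sub_zero] at h5
    exact h5
  have htop : Tendsto G atTop (𝓝 (inner ℂ (u 0 : H) (u t : H) -
      ∫ l, Complex.exp (Complex.I * t * l) ∂μ)) := by
    have h1 : Tendsto (fun l => inner ℂ (u 0 : H) (E.proj l (u t))) atTop
        (𝓝 (inner ℂ (u 0 : H) (u t : H))) :=
      (tendsto_const_nhds (x := (u 0 : H))).inner (𝕜 := ℂ) (E.tendsto_atTop (u t))
    have h2 := tendsto_setIntegral_of_monotone (μ := μ) (f := fun x : ℝ =>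
      Complex.exp (Complex.I * t * x)) (s := fun l : ℝ => Set.Iic l)
      (fun _ => measurableSet_Iic) (fun a b h => Set.Iic_subset_Iic.2 h) hint.integrableOn
    rw [Set.iUnion_Iic, setIntegral_univ] at h2
    exact h1.sub h2
  have hG0 : ∀ l, G l = 0 := fun l =>
    tendsto_nhds_unique (tendsto_const_nhds.congr' (by
      filter_upwards [eventually_le_atBot l] with a ha using hconst a l ha)) hbot
  have := tendsto_nhds_unique (htop.congr hG0) tendsto_const_nhds
  exact sub_eq_zero.1 this

end IsResolutionOf

end ResolutionOfIdentity

/-! ### Gaussians as Schwartz functions -/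

theorem exists_abs_eval_mul_exp_le {c : ℝ} (hc : 0 < c) (p : Polynomial ℝ) :
    ∃ C, ∀ x : ℝ, |p.eval x * Real.exp (-c * x ^ 2)| ≤ C := by
  induction p using Polynomial.induction_on' with
  | add p q hp hq =>
    obtain ⟨C, hC⟩ := hp
    obtain ⟨D, hD⟩ := hq
    refine ⟨C + D, fun x => ?_⟩
    rw [Polynomial.eval_add, add_mul]
    exact (abs_add_le _ _).trans (add_le_add (hC x) (hD x))
  | monomial n a =>
    refine ⟨|a| * (1 + n.factorial / c ^ n), fun x => ?_⟩
    rw [Polynomial.eval_monomial, mul_assoc, abs_mul]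
    gcongr
    rw [abs_mul, Real.abs_exp, abs_pow]
    have h1 : |x| ^ n ≤ 1 + (x ^ 2) ^ n := by
      rcases le_total (|x| ^ n) 1 with h | h
      · have : 0 ≤ (x ^ 2) ^ n := by positivity
        linarith
      · rw [← sq_abs, ← pow_mul, mul_comm 2 n, pow_mul]
        nlinarith
    have h2 := Real.pow_div_factorial_le_exp (c * x ^ 2) (by positivity) n
    have h3 : (x ^ 2) ^ n * Real.exp (-c * x ^ 2) ≤ n.factorial / c ^ n := by
      rw [neg_mul, Real.exp_neg, ← div_eq_mul_inv, div_le_div_iff₀ (Real.exp_pos _) (by positivity),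
        ← mul_pow, mul_comm (x ^ 2) c]
      rw [div_le_iff₀ (by positivity)] at h2
      linarith
    have h4 : Real.exp (-c * x ^ 2) ≤ 1 := Real.exp_le_one_iff.2 (by nlinarith [sq_nonneg x])
    calc _ ≤ (1 + (x ^ 2) ^ n) * Real.exp (-c * x ^ 2) := by gcongr
      _ ≤ _ := by rw [add_mul, one_mul]; linarith

theorem iteratedDeriv_gaussian (c : ℝ) (n : ℕ) : ∃ p : Polynomial ℝ,
    iteratedDeriv n (fun x : ℝ => ((Real.exp (-c * x ^ 2) : ℝ) : ℂ)) =
      fun x => ((p.eval x * Real.exp (-c * x ^ 2) : ℝ) : ℂ) := by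
  induction n with
  | zero => exact ⟨1, by simp⟩
  | succ n ih =>
    obtain ⟨p, hp⟩ := ih
    refine ⟨p.derivative - Polynomial.C (2 * c) * Polynomial.X * p, ?_⟩
    rw [iteratedDeriv_succ, hp]
    funext x
    have h1 : HasDerivAt (fun x : ℝ => Real.exp (-c * x ^ 2))
        (Real.exp (-c * x ^ 2) * (-c * (2 * x))) x := by
      refine HasDerivAt.exp ?_
      simpa using (hasDerivAt_pow 2 x).const_mul (-c)
    have h2 := ((p.hasDerivAt x).mul h1).ofReal_comp
    refine h2.deriv.trans ?_
    congr 1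
    simp only [Polynomial.eval_sub, Polynomial.eval_mul, Polynomial.eval_C, Polynomial.eval_X]
    ring

/-- The Gaussian `x ↦ e^(-cx²)`, `c > 0`, as a Schwartz function. -/
noncomputable def gaussian (c : ℝ) (hc : 0 < c) : 𝓢(ℝ, ℂ) where
  toFun x := ((Real.exp (-c * x ^ 2) : ℝ) : ℂ)
  smooth' := by
    have h : ContDiff ℝ ∞ fun x : ℝ => Real.exp (-c * x ^ 2) := by fun_prop
    exact Complex.ofRealCLM.contDiff.comp h
  decay' k n := by
    obtain ⟨p, hp⟩ := iteratedDeriv_gaussian c n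
    obtain ⟨C, hC⟩ := exists_abs_eval_mul_exp_le hc (Polynomial.X ^ k * p)
    refine ⟨C, fun x => ?_⟩
    rw [norm_iteratedFDeriv_eq_norm_iteratedDeriv, hp, Complex.norm_real]
    refine le_trans (le_of_eq ?_) (hC x)
    simp only [Polynomial.eval_mul, Polynomial.eval_pow, Polynomial.eval_X, abs_mul, abs_pow,
      Real.norm_eq_abs, mul_assoc]

theorem gaussian_apply (c : ℝ) (hc : 0 < c) (x : ℝ) :
    gaussian c hc x = ((Real.exp (-c * x ^ 2) : ℝ) : ℂ) := rfl

/-! ### Differentiation in `L²` -/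

theorem norm_sq_eq_integral {α F : Type*} [MeasurableSpace α] {μ : Measure α}
    [NormedAddCommGroup F] [InnerProductSpace ℂ F] (f : Lp F 2 μ) : ‖f‖ ^ 2 = ∫ x, ‖f x‖ ^ 2 ∂μ := by
  rw [← inner_self_eq_norm_sq (𝕜 := ℂ), L2.inner_def]
  have h : (fun x => inner ℂ (f x) (f x)) = fun x => ((‖f x‖ ^ 2 : ℝ) : ℂ) := by
    funext x
    rw [inner_self_eq_norm_sq_to_K]
    simp
  rw [h, integral_complex_ofReal]
  simp

/-- Dominated differentiation under the `L²` norm. -/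
theorem hasDerivAt_Lp_two_of_dominated {α : Type*} [MeasurableSpace α] {μ : Measure α}
    {F F' : ℝ → α → ℂ} {u : ℝ → Lp ℂ 2 μ} {v : Lp ℂ 2 μ} {t : ℝ} {B : α → ℝ}
    (hu : ∀ s, u s =ᵐ[μ] F s) (hv : v =ᵐ[μ] F' t)
    (hF : ∀ s x, HasDerivAt (fun s => F s x) (F' s x) s) (hB : MemLp B 2 μ)
    (hF' : ∀ s ∈ Metric.ball t 1, ∀ x, ‖F' s x‖ ≤ B x) : HasDerivAt u v t := by
  rw [hasDerivAt_iff_tendsto_slope]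
  rw [tendsto_iff_norm_sub_tendsto_zero]
  have key : Tendsto (fun s => ‖slope u t s - v‖ ^ 2) (𝓝[≠] t) (𝓝 0) := by
    have hae : ∀ s, (fun x => ‖(slope u t s - v) x‖ ^ 2) =ᵐ[μ]
        fun x => ‖slope (fun s => F s x) t s - F' t x‖ ^ 2 := by
      intro s
      rw [slope_def_module]
      filter_upwards [hu s, hu t, hv, Lp.coeFn_sub ((s - t)⁻¹ • (u s - u t)) v,
        Lp.coeFn_smul (s - t)⁻¹ (u s - u t), Lp.coeFn_sub (u s) (u t)] with x h1 h2 h3 h4 h5 h6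
      rw [h4, Pi.sub_apply, h5, Pi.smul_apply, h6, Pi.sub_apply, h1, h2, h3, slope_def_module]
    have h0 : ∀ s, ‖slope u t s - v‖ ^ 2 =
        ∫ x, ‖slope (fun s => F s x) t s - F' t x‖ ^ 2 ∂μ := fun s => by
      rw [norm_sq_eq_integral, integral_congr_ae (hae s)]
    simp only [h0]
    have hz : (0 : ℝ) = ∫ _, (0 : ℝ) ∂μ := by simp
    rw [hz]
    refine tendsto_integral_filter_of_dominated_convergence (fun x => (2 * B x) ^ 2) ?_ ?_ ?_ ?_
    · refine Eventually.of_forall fun s => ?_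
      refine AEStronglyMeasurable.congr ?_ (hae s)
      exact ((Lp.aestronglyMeasurable _).norm.pow 2)
    · have hmem : Metric.ball t 1 ∈ 𝓝[≠] t :=
        mem_nhdsWithin_of_mem_nhds (Metric.ball_mem_nhds t one_pos)
      filter_upwards [hmem, self_mem_nhdsWithin] with s hs hst
      refine Eventually.of_forall fun x => ?_
      rw [Real.norm_eq_abs, abs_of_nonneg (by positivity)]
      have ht : t ∈ Metric.ball t (1 : ℝ) := Metric.mem_ball_self one_pos
      have h1 := (convex_ball t (1 : ℝ)).norm_image_sub_le_of_norm_hasDerivWithin_le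
        (f := fun s => F s x) (fun s _ => (hF s x).hasDerivWithinAt) (fun s hs => hF' s hs x) ht hs
      have h2 : ‖slope (fun s => F s x) t s‖ ≤ B x := by
        rw [slope_def_module, norm_smul, norm_inv]
        exact inv_mul_le_of_le_mul₀ (norm_nonneg _) ((norm_nonneg _).trans (hF' t ht x))
          (h1.trans (le_of_eq (mul_comm _ _)))
      have h3 := hF' t ht x
      gcongr
      calc _ ≤ _ := norm_sub_le _ _
        _ ≤ 2 * B x := by linarith
    · exact (hB.const_mul 2).integrable_sq
    · refine Eventually.of_forall fun x => ?_
      have h1 := (hasDerivAt_iff_tendsto_slope.1 (hF t x)).sub_const (F' t x)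
      have h2 := (h1.norm.pow 2)
      simpa using h2
  have h := key.sqrt
  simpa using h

/-! ### The evolution of the vacuum -/

/-- The value at `x` of `e^{it(XP+PX)} Φ`, that is, `e^t Φ(e^{2t} x)`. -/
noncomputable def flowFun (t x : ℝ) : ℝ :=
  Real.pi ^ (-(1 / 4) : ℝ) * Real.exp t * Real.exp (-(Real.exp (4 * t) / 2) * x ^ 2)

/-- The dilated Gaussian `x ↦ e^t Φ(e^{2t} x)` as a Schwartz function. -/
noncomputable def flow (t : ℝ) : 𝓢(ℝ, ℂ) :=
  ((Real.pi ^ (-(1 / 4) : ℝ) * Real.exp t : ℝ) : ℂ) •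
    gaussian (Real.exp (4 * t) / 2) (by positivity)

theorem flow_apply (t x : ℝ) : flow t x = (flowFun t x : ℂ) := by
  simp [flow, flowFun, gaussian_apply]

theorem schwartzToL2_coeFn (f : 𝓢(ℝ, ℂ)) : schwartzToL2 f =ᵐ[volume] f :=
  SchwartzMap.coeFn_toLp f 2 volume

theorem vacuum_eq : vacuum = schwartzToL2 (flow 0) := by
  refine Lp.ext ?_
  filter_upwards [schwartzToL2_coeFn (flow 0), memLp_vacuumFun.coeFn_toLp] with x h1 h2
  rw [h1, flow_apply]
  refine h2.trans ?_
  simp only [vacuumFun, flowFun, mul_zero, Real.exp_zero, mul_one]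
  congr 3
  ring

theorem hasDerivAt_flowFun_space (t x : ℝ) :
    HasDerivAt (flowFun t) (-(Real.exp (4 * t) * x) * flowFun t x) x := by
  have h : HasDerivAt (fun x : ℝ => Real.exp (-(Real.exp (4 * t) / 2) * x ^ 2))
      (Real.exp (-(Real.exp (4 * t) / 2) * x ^ 2) * (-(Real.exp (4 * t) / 2) * (2 * x))) x := by
    refine HasDerivAt.exp ?_
    simpa using (hasDerivAt_pow 2 x).const_mul (-(Real.exp (4 * t) / 2))
  convert! h.const_mul (Real.pi ^ (-(1 / 4) : ℝ) * Real.exp t) using 1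
  simp only [flowFun]
  ring

theorem hasDerivAt_flowFun_time (t x : ℝ) :
    HasDerivAt (fun t => flowFun t x) ((1 - 2 * Real.exp (4 * t) * x ^ 2) * flowFun t x) t := by
  have h1 : HasDerivAt (fun t : ℝ => -(Real.exp (4 * t) / 2) * x ^ 2)
      (-(Real.exp (4 * t) * 4 / 2) * x ^ 2) t := by
    have h : HasDerivAt (fun t : ℝ => Real.exp (4 * t)) (Real.exp (4 * t) * 4) t := by
      refine HasDerivAt.exp ?_
      simpa using (hasDerivAt_id t).const_mul 4
    exact (h.div_const 2).neg.mul_const _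
  convert! ((Real.hasDerivAt_exp t).const_mul (Real.pi ^ (-(1 / 4) : ℝ))).mul h1.exp using 1
  simp only [flowFun]
  ring

theorem schwartzAnticomm_apply (f : 𝓢(ℝ, ℂ)) (x : ℝ) :
    (position (momentum f) + momentum (position f)) x =
      -Complex.I * (2 * x * deriv f x + f x) := by
  have h : HasDerivAt (position f) (1 * f x + x * deriv f x) x := by
    have h1 : (position f : ℝ → ℂ) = fun x : ℝ => (x : ℂ) * f x := funext (position_apply f)
    rw [h1]
    exact (Complex.ofRealCLM.hasDerivAt (x := x)).mul f.differentiableAt.hasDerivAt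
  rw [_root_.add_apply, position_apply, momentum_apply, momentum_apply, h.deriv]
  ring

theorem hasDerivAt_flow (t : ℝ) : HasDerivAt (fun s => schwartzToL2 (flow s))
    (Complex.I • schwartzToL2 (position (momentum (flow t)) + momentum (position (flow t)))) t := by
  set k := Real.exp (4 * (t - 1)) with hk
  have hB : MemLp (fun x : ℝ => 8 * Real.pi ^ (-(1 / 4) : ℝ) * Real.exp (t + 1) *
      Real.exp (-(k / 4) * x ^ 2)) 2 := by
    refine MemLp.const_mul ?_ _
    rw [memLp_two_iff_integrable_sq (by fun_prop)]
    refine (integrable_exp_neg_mul_sq (b := k / 2) (by positivity)).congr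
      (Eventually.of_forall fun x => ?_)
    simp only
    rw [← Real.exp_nat_mul]
    congr 1
    push_cast
    ring
  refine hasDerivAt_Lp_two_of_dominated (F := fun s x => (flowFun s x : ℂ))
    (F' := fun s x => (((1 - 2 * Real.exp (4 * s) * x ^ 2) * flowFun s x : ℝ) : ℂ)) (fun s => ?_) ?_
    (fun s x => (hasDerivAt_flowFun_time s x).ofReal_comp) hB ?_
  · filter_upwards [schwartzToL2_coeFn (flow s)] with x hx
    rw [hx, flow_apply]
  · filter_upwards [Lp.coeFn_smul Complex.I (schwartzToL2 (position (momentum (flow t)) +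
      momentum (position (flow t)))), schwartzToL2_coeFn (position (momentum (flow t)) +
      momentum (position (flow t)))] with x h1 h2
    rw [h1, Pi.smul_apply, h2, schwartzAnticomm_apply]
    have h3 : (flow t : ℝ → ℂ) = fun x => (flowFun t x : ℂ) := funext (flow_apply t)
    rw [h3, (hasDerivAt_flowFun_space t x).ofReal_comp.deriv, smul_eq_mul]
    push_cast
    linear_combination (-(2 * x * (-(Complex.exp (4 * t) * x) * flowFun t x) + flowFun t x)) *
      Complex.I_sq
  · intro s hs x
    rw [Metric.mem_ball, Real.dist_eq, abs_lt] at hs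
    set y := Real.exp (4 * s) * x ^ 2 with hy
    have hy0 : 0 ≤ y := by positivity
    have hky : k * x ^ 2 ≤ y := by
      rw [hy, hk]
      gcongr
      linarith
    have h1 : |1 - 2 * y| ≤ 8 * Real.exp (y / 4) := by
      have := Real.add_one_le_exp (y / 4)
      rw [abs_le]
      constructor <;> linarith
    have h2 : Real.exp s ≤ Real.exp (t + 1) := Real.exp_le_exp.2 (by linarith)
    have h3 : Real.exp (y / 4) * Real.exp (-(y / 2)) ≤ Real.exp (-(k / 4) * x ^ 2) := by
      rw [← Real.exp_add]
      exact Real.exp_le_exp.2 (by linarith)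
    have e1 : 2 * Real.exp (4 * s) * x ^ 2 = 2 * y := by rw [hy]; ring
    have e2 : flowFun s x = Real.pi ^ (-(1 / 4) : ℝ) * Real.exp s * Real.exp (-(y / 2)) := by
      rw [flowFun, hy]; congr 2; ring
    rw [e1, e2, Complex.norm_real, Real.norm_eq_abs, abs_mul, abs_of_nonneg (a := _ * _) (by positivity)]
    calc _ ≤ 8 * Real.exp (y / 4) *
          (Real.pi ^ (-(1 / 4) : ℝ) * Real.exp (t + 1) * Real.exp (-(y / 2))) := by gcongr
      _ = 8 * Real.pi ^ (-(1 / 4) : ℝ) * Real.exp (t + 1) *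
          (Real.exp (y / 4) * Real.exp (-(y / 2))) := by ring
      _ ≤ _ := by gcongr

/-- The vacuum characteristic function `(sech 2t)^(1/2)`. -/
noncomputable def sechSqrt (t : ℝ) : ℝ := (1 / Real.cosh (2 * t)) ^ (1 / 2 : ℝ)

theorem inner_flow (t : ℝ) :
    inner ℂ (schwartzToL2 (flow 0)) (schwartzToL2 (flow t)) = (sechSqrt t : ℂ) := by
  have h1 : inner ℂ (schwartzToL2 (flow 0)) (schwartzToL2 (flow t)) =
      ∫ x : ℝ, ((Real.pi ^ (-(1 / 2) : ℝ) * Real.exp t *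
        Real.exp (-((1 + Real.exp (4 * t)) / 2) * x ^ 2) : ℝ) : ℂ) := by
    rw [L2.inner_def]
    refine integral_congr_ae ?_
    filter_upwards [schwartzToL2_coeFn (flow 0), schwartzToL2_coeFn (flow t)] with x h1 h2
    rw [h1, h2, flow_apply, flow_apply, RCLike.inner_apply, Complex.conj_ofReal,
      ← Complex.ofReal_mul]
    congr 1
    have e1 : Real.pi ^ (-(1 / 2) : ℝ) = Real.pi ^ (-(1 / 4) : ℝ) * Real.pi ^ (-(1 / 4) : ℝ) := by
      rw [← Real.rpow_add Real.pi_pos]; norm_num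
    have e2 : Real.exp (-((1 + Real.exp (4 * t)) / 2) * x ^ 2) =
        Real.exp (-(Real.exp (4 * t) / 2) * x ^ 2) * Real.exp (-(Real.exp (4 * 0) / 2) * x ^ 2) := by
      rw [← Real.exp_add]; congr 1; simp; ring
    rw [flowFun, flowFun, e1, e2]
    simp
    ring
  rw [h1, integral_complex_ofReal, integral_const_mul, integral_gaussian]
  congr 1
  rw [sechSqrt, ← Real.sqrt_eq_rpow, Real.rpow_neg Real.pi_pos.le, ← Real.sqrt_eq_rpow]
  have e1 : Real.exp t = √(Real.exp (2 * t)) := by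
    rw [two_mul, Real.exp_add, Real.sqrt_mul_self (Real.exp_pos _).le]
  rw [e1, ← Real.sqrt_inv, ← Real.sqrt_mul (by positivity), ← Real.sqrt_mul (by positivity)]
  congr 1
  rw [Real.cosh_eq]
  have e2 : Real.exp (4 * t) = Real.exp (2 * t) * Real.exp (2 * t) := by
    rw [← Real.exp_add]; ring_nf
  have e3 : Real.exp (-(2 * t)) = (Real.exp (2 * t))⁻¹ := Real.exp_neg _
  rw [e2, e3]
  have := Real.exp_pos (2 * t)
  have := Real.pi_pos
  field_simp
  ring

/-- For every self-adjoint extension, the spectral measure of the vacuum has the characteristic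
function `(sech 2t)^(1/2)`. -/
theorem integral_exp_measure_vacuum {T : L2 →ₗ.[ℂ] L2} {E : ResolutionOfIdentity L2}
    (hT : IsSelfAdjoint T) (hA : anticomm ≤ T) (hE : E.IsResolutionOf T) (t : ℝ) :
    ∫ l, Complex.exp (Complex.I * t * l) ∂E.measure vacuum = (sechSqrt t : ℂ) := by
  set u : ℝ → T.domain := fun s => ⟨schwartzToL2 (flow s), hA.1 (schwartzToL2_mem_domain _)⟩ with hu
  have h := hE.inner_eq_integral_exp hT (u := u) (fun s => ?_) t
  · rw [vacuum_eq, ← inner_flow]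
    exact h.symm
  · have h1 : T (u s) = schwartzToL2 (position (momentum (flow s)) + momentum (position (flow s))) := by
      rw [← anticomm_apply]
      exact (hA.2 rfl).symm
    rw [h1]
    exact hasDerivAt_flow s

/-! ### The power series of the incomplete Beta function -/

theorem mul_ofReal_cpow {z : ℂ} (hz : z ≠ 0) {s : ℝ} (hs : 0 < s) (c : ℂ) :
    (z * s) ^ c = z ^ c * (s : ℂ) ^ c := by
  have hs' : (s : ℂ) ≠ 0 := Complex.ofReal_ne_zero.2 hs.ne'
  rw [Complex.cpow_def_of_ne_zero (mul_ne_zero hz hs'), Complex.cpow_def_of_ne_zero hz,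
    Complex.cpow_def_of_ne_zero hs', Complex.log_mul_ofReal s hs z hz, Complex.ofReal_log hs.le,
    add_mul, add_comm, Complex.exp_add]

/-- The coefficient `(1-b)_n / n!` of `w^n` in `(1-w)^(b-1)`. -/
noncomputable def betaCoeff (b : ℝ) (n : ℕ) : ℂ :=
  (ascPochhammer ℂ n).eval (1 - (b : ℂ)) / (n.factorial : ℂ)

theorem betaCoeff_eq_choose (b : ℝ) (n : ℕ) :
    betaCoeff b n = Ring.choose ((1 - (b : ℂ)) + n - 1) n := by
  have h1 := Ring.factorial_nsmul_multichoose_eq_ascPochhammer (1 - (b : ℂ)) n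
  rw [Polynomial.ascPochhammer_smeval_eq_eval, nsmul_eq_mul] at h1
  have h2 : Ring.choose ((1 - (b : ℂ)) + n - 1) n = Ring.multichoose (1 - (b : ℂ)) n := by
    rw [Ring.choose]
    congr 1
    ring
  rw [h2, betaCoeff, ← h1, mul_div_cancel_left₀]
  exact Nat.cast_ne_zero.2 n.factorial_ne_zero

theorem hasFPowerSeries_betaCoeff (b : ℝ) : HasFPowerSeriesOnBall
    (fun x : ℂ => 1 / (1 - x) ^ (1 - (b : ℂ))) (.ofScalars ℂ (betaCoeff b)) 0 1 := by
  have h := Complex.one_div_one_sub_cpow_hasFPowerSeriesOnBall_zero (1 - (b : ℂ))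
  have e : betaCoeff b = fun n : ℕ => Ring.choose ((1 - (b : ℂ)) + n - 1) n :=
    funext (betaCoeff_eq_choose b)
  rwa [e]

theorem hasSum_betaCoeff (b : ℝ) {w : ℂ} (hw : ‖w‖ < 1) :
    HasSum (fun n => betaCoeff b n * w ^ n) ((1 - w) ^ ((b : ℂ) - 1)) := by
  have h := (hasFPowerSeries_betaCoeff b).hasSum (y := w) (by
    rw [Metric.mem_eball, edist_zero_right, enorm_eq_nnnorm]
    exact_mod_cast hw)
  rw [zero_add, one_div, ← Complex.cpow_neg, neg_sub] at h
  refine h.congr_fun ?_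
  intro n
  simp [mul_comm]

theorem summable_norm_betaCoeff (b : ℝ) {w : ℂ} (hw : ‖w‖ < 1) :
    Summable fun n => ‖betaCoeff b n * w ^ n‖ := (hasSum_betaCoeff b hw).summable.norm

theorem betaCoeff_succ (b : ℝ) (n : ℕ) :
    betaCoeff b (n + 1) = betaCoeff b n * ((n + 1 - b : ℝ) / (n + 1 : ℝ) : ℝ) := by
  rw [betaCoeff, betaCoeff, ascPochhammer_succ_eval, Nat.factorial_succ]
  have : (n : ℂ) + 1 ≠ 0 := by exact_mod_cast n.succ_ne_zero
  have : (n.factorial : ℂ) ≠ 0 := Nat.cast_ne_zero.2 n.factorial_ne_zero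
  push_cast
  field_simp
  ring

/-- For `b > 0`, eventually `b ‖c_n‖ / (n+1) = ‖c_n‖ - ‖c_{n+1}‖`, and the series telescopes. -/
theorem summable_norm_betaCoeff_div {b : ℝ} (hb : 0 < b) :
    Summable fun n : ℕ => ‖betaCoeff b n‖ / (n + 1) := by
  obtain ⟨N, hN⟩ := exists_nat_ge b
  have hstep : ∀ n, N ≤ n → b * (‖betaCoeff b n‖ / (n + 1)) =
      ‖betaCoeff b n‖ - ‖betaCoeff b (n + 1)‖ := by
    intro n hn
    have h1 : b ≤ n := hN.trans (Nat.cast_le.2 hn)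
    have h2 : (0 : ℝ) < n + 1 := by positivity
    rw [betaCoeff_succ, norm_mul, Complex.norm_real, Real.norm_eq_abs,
      abs_of_nonneg (div_nonneg (by linarith) h2.le)]
    field_simp
    ring
  rw [← summable_nat_add_iff N]
  refine summable_of_sum_range_le (c := ‖betaCoeff b N‖ / b) (fun n => by positivity) fun n => ?_
  have hsum : b * ∑ i ∈ Finset.range n, ‖betaCoeff b (i + N)‖ / ((i + N : ℕ) + 1) =
      ‖betaCoeff b N‖ - ‖betaCoeff b (n + N)‖ := by
    rw [Finset.mul_sum, Finset.sum_congr rfl fun i _ => hstep (i + N) (Nat.le_add_left _ _)]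
    have := Finset.sum_range_sub' (fun i => ‖betaCoeff b (i + N)‖) n
    simp only [zero_add] at this
    rw [← this]
    refine Finset.sum_congr rfl fun i _ => ?_
    rw [add_right_comm]
  rw [le_div_iff₀' hb, hsum]
  linarith [norm_nonneg (betaCoeff b (n + N))]

theorem summable_beta_norm {z : ℂ} {r b : ℝ} (hr : 0 < r) (h : ‖z‖ < 1 ∨ ‖z‖ ≤ 1 ∧ 0 < b) :
    Summable fun n : ℕ => ‖betaCoeff b n * z ^ n‖ * (1 / (r + n)) := by
  rcases h with hz | ⟨hz, hb⟩
  · refine Summable.of_nonneg_of_le (fun n => by positivity) (fun n => ?_)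
      ((summable_norm_betaCoeff b hz).mul_right (1 / r))
    gcongr
    linarith [(Nat.cast_nonneg n : (0 : ℝ) ≤ n)]
  · refine Summable.of_nonneg_of_le (fun n => by positivity) (fun n => ?_)
      ((summable_norm_betaCoeff_div hb).mul_right (1 + 1 / r))
    have h1 : ‖betaCoeff b n * z ^ n‖ ≤ ‖betaCoeff b n‖ := by
      rw [norm_mul, norm_pow]
      exact mul_le_of_le_one_right (norm_nonneg _) (pow_le_one₀ (norm_nonneg _) hz)
    have h2 : 1 / (r + n) ≤ 1 / ((n : ℝ) + 1) * (1 + 1 / r) := by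
      have hn : (0 : ℝ) ≤ n := Nat.cast_nonneg n
      have e : 1 / ((n : ℝ) + 1) * (1 + 1 / r) = (r + 1) / (((n : ℝ) + 1) * r) := by
        field_simp
      rw [e, div_le_div_iff₀ (by positivity) (by positivity)]
      nlinarith [mul_nonneg hr.le hn]
    calc _ ≤ ‖betaCoeff b n‖ * (1 / ((n : ℝ) + 1) * (1 + 1 / r)) := by gcongr
      _ = _ := by ring

theorem hasSum_incompleteBeta {z a : ℂ} {b : ℝ} (ha : 0 < a.re)
    (h : ‖z‖ < 1 ∨ ‖z‖ ≤ 1 ∧ 0 < b) :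
    HasSum (fun n : ℕ => z ^ a * (((ascPochhammer ℂ n).eval (1 - (b : ℂ)) /
      ((n.factorial : ℂ) * (a + n))) * z ^ n)) (incompleteBeta z a b) := by
  have hz1 : ‖z‖ ≤ 1 := h.elim le_of_lt fun h => h.1
  have ha0 : a ≠ 0 := fun h => by simp [h] at ha
  by_cases hz : z = 0
  · subst hz
    simp [incompleteBeta, Complex.zero_cpow ha0, hasSum_zero]
  set f : ℕ → ℝ → ℂ := fun n s => z ^ a * (betaCoeff b n * z ^ n) * (s : ℂ) ^ (a - 1 + n) with hf
  have hre : ∀ n : ℕ, -1 < (a - 1 + n).re := by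
    intro n
    have : (0 : ℝ) ≤ n := Nat.cast_nonneg n
    simp
    linarith
  have hint : ∀ n, IntegrableOn (f n) (Set.Ioo 0 1) := by
    intro n
    have h1 := (intervalIntegral.intervalIntegrable_cpow' (a := 0) (b := 1) (hre n)).const_mul
      (z ^ a * (betaCoeff b n * z ^ n))
    exact (intervalIntegrable_iff_integrableOn_Ioo_of_le zero_le_one).1 h1
  have hval : ∀ n, ∫ s in Set.Ioo (0 : ℝ) 1, f n s = z ^ a *
      (((ascPochhammer ℂ n).eval (1 - (b : ℂ)) / ((n.factorial : ℂ) * (a + n))) * z ^ n) := by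
    intro n
    have han : a + n ≠ 0 := fun h => by
      have := congrArg Complex.re h
      simp at this
      linarith [(Nat.cast_nonneg n : (0 : ℝ) ≤ n)]
    have e : a - 1 + n + 1 = a + n := by ring
    rw [← integral_Ioc_eq_integral_Ioo, ← intervalIntegral.integral_of_le zero_le_one,
      intervalIntegral.integral_const_mul, integral_cpow (Or.inl (hre n)), e, Complex.ofReal_one,
      Complex.ofReal_zero, Complex.one_cpow, Complex.zero_cpow han, betaCoeff]
    field_simp
    ring
  have hnorm : ∀ n, ∫ s in Set.Ioo (0 : ℝ) 1, ‖f n s‖ =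
      ‖z ^ a‖ * (‖betaCoeff b n * z ^ n‖ * (1 / (a.re + n))) := by
    intro n
    have h1 : ∀ s ∈ Set.Ioo (0 : ℝ) 1, ‖f n s‖ =
        ‖z ^ a‖ * ‖betaCoeff b n * z ^ n‖ * s ^ (a.re - 1 + n) := by
      intro s hs
      rw [hf, norm_mul, norm_mul, Complex.norm_cpow_eq_rpow_re_of_pos hs.1]
      simp
    have e : a.re - 1 + n + 1 = a.re + n := by ring
    have hn : (0 : ℝ) ≤ n := Nat.cast_nonneg n
    rw [setIntegral_congr_fun measurableSet_Ioo h1, ← integral_Ioc_eq_integral_Ioo,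
      ← intervalIntegral.integral_of_le zero_le_one, intervalIntegral.integral_const_mul,
      integral_rpow (Or.inl (by linarith)), e, Real.one_rpow, Real.zero_rpow (by positivity)]
    ring
  have hsum := hasSum_integral_of_summable_integral_norm hint (by
    simp only [hnorm]
    exact (summable_beta_norm ha h).mul_left _)
  simp only [hval] at hsum
  convert! hsum using 1
  rw [incompleteBeta, intervalIntegral.integral_of_le zero_le_one, integral_Ioc_eq_integral_Ioo]
  refine setIntegral_congr_fun measurableSet_Ioo fun s hs => ?_
  have hs' : (s : ℂ) ≠ 0 := Complex.ofReal_ne_zero.2 hs.1.ne'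
  have hzs : ‖z * s‖ < 1 := by
    rw [norm_mul, Complex.norm_real, Real.norm_eq_abs, abs_of_pos hs.1]
    calc _ ≤ 1 * s := by gcongr; exact hs.1.le
      _ < 1 := by linarith [hs.2]
  have h2 := (hasSum_betaCoeff b hzs).mul_left ((z * s) ^ (a - 1) * z)
  refine Eq.trans ?_ (h2.congr_fun ?_).tsum_eq.symm
  · ring
  · intro n
    simp only [hf]
    rw [mul_ofReal_cpow hz hs.1, Complex.cpow_sub _ _ hz, Complex.cpow_one,
      Complex.cpow_add _ _ hs', Complex.cpow_natCast, mul_pow]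
    field_simp

/-! ### Densities and characteristic functions -/

theorem charFun_withDensity_ofReal {p : ℝ → ℝ} (hp : Integrable p) (t : ℝ) :
    charFun (volume.withDensity fun x => ENNReal.ofReal (p x)) t =
      ∫ x : ℝ, Complex.exp (t * x * Complex.I) * (max (p x) 0 : ℝ) := by
  rw [charFun_apply_real, integral_withDensity_eq_integral_toReal_smul₀
    hp.aestronglyMeasurable.aemeasurable.ennreal_ofReal
    (Eventually.of_forall fun x => ENNReal.ofReal_lt_top)]
  congr 1
  funext x
  rw [ENNReal.toReal_ofReal', Complex.real_smul, mul_comm]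

/-- A finite measure whose characteristic function is that of an integrable function `p` has the
distribution function `∫_{-∞}^l p`. No sign of `p` is needed: the negative part of `p` is moved to
the side of the measure, and both sides are then finite measures. -/
theorem real_Iic_eq_integral_of_charFun {μ : Measure ℝ} [IsFiniteMeasure μ] {p : ℝ → ℝ}
    (hp : Integrable p)
    (h : ∀ t : ℝ, charFun μ t = ∫ x : ℝ, Complex.exp (t * x * Complex.I) * (p x : ℂ)) (l : ℝ) :
    μ.real (Set.Iic l) = ∫ x in Set.Iic l, p x := by
  set ν₁ := volume.withDensity fun x => ENNReal.ofReal (p x) with hν₁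
  set ν₂ := volume.withDensity fun x => ENNReal.ofReal (-p x) with hν₂
  have hf₁ : IsFiniteMeasure ν₁ := isFiniteMeasure_withDensity_ofReal hp.2
  have hf₂ : IsFiniteMeasure ν₂ := isFiniteMeasure_withDensity_ofReal hp.neg.2
  have hint : ∀ (t : ℝ) {q : ℝ → ℝ}, Integrable q →
      Integrable fun x : ℝ => Complex.exp (t * x * Complex.I) * (q x : ℂ) := by
    intro t q hq
    refine hq.ofReal.bdd_mul (c := 1) (by fun_prop) (Eventually.of_forall fun x => ?_)
    rw [← Complex.ofReal_mul, Complex.norm_exp_ofReal_mul_I]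
  have hμ : μ + ν₂ = ν₁ := by
    refine Measure.ext_of_charFun ?_
    funext t
    have h1 : charFun (μ + ν₂) t = charFun μ t + charFun ν₂ t := by
      simp only [charFun_apply_real]
      refine integral_add_measure ?_ ?_ <;>
      · refine Integrable.of_bound (C := 1) (by fun_prop) (Eventually.of_forall fun x => ?_)
        rw [← Complex.ofReal_mul, Complex.norm_exp_ofReal_mul_I]
    rw [h1, h, charFun_withDensity_ofReal hp, charFun_withDensity_ofReal (p := fun x => -p x) hp.neg,
      ← integral_add (hint t hp) (hint t (q := fun x => max (-p x) 0) hp.neg.pos_part)]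
    congr 1
    funext x
    rw [← mul_add, ← Complex.ofReal_add]
    congr 2
    rcases le_total (p x) 0 with hx | hx
    · rw [max_eq_right hx, max_eq_left (by linarith)]; ring
    · rw [max_eq_left hx, max_eq_right (by linarith)]; ring
  have hreal : μ.real (Set.Iic l) + ν₂.real (Set.Iic l) = ν₁.real (Set.Iic l) := by
    rw [← hμ, measureReal_add_apply]
  have hi := integral_eq_lintegral_pos_part_sub_lintegral_neg_part (hp.integrableOn (s := Set.Iic l))
  rw [hi, ← withDensity_apply _ measurableSet_Iic, ← withDensity_apply _ measurableSet_Iic]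
  change _ = ν₁.real (Set.Iic l) - ν₂.real (Set.Iic l)
  linarith

/-! ### The Fourier transform of `(sech 2t)^(1/2)` -/

theorem sechSqrt_pos (t : ℝ) : 0 < sechSqrt t :=
  Real.rpow_pos_of_pos (one_div_pos.2 (Real.cosh_pos _)) _

theorem sechSqrt_neg (t : ℝ) : sechSqrt (-t) = sechSqrt t := by
  rw [sechSqrt, mul_neg, Real.cosh_neg, sechSqrt]

theorem sechSqrt_eq (t : ℝ) :
    sechSqrt t = √2 * Real.exp (-t) * (1 + Real.exp (-(4 * t))) ^ (-(1 / 2) : ℝ) := by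
  have h1 : 1 / Real.cosh (2 * t) = 2 * Real.exp (-t) ^ 2 * (1 + Real.exp (-(4 * t)))⁻¹ := by
    have e1 : Real.exp (2 * t) = (Real.exp (-t) ^ 2)⁻¹ := by
      rw [← Real.exp_nat_mul, ← Real.exp_neg]; congr 1; push_cast; ring
    have e2 : Real.exp (-(2 * t)) = Real.exp (-t) ^ 2 := by
      rw [← Real.exp_nat_mul]; congr 1; push_cast; ring
    have e3 : Real.exp (-(4 * t)) = Real.exp (-t) ^ 4 := by
      rw [← Real.exp_nat_mul]; congr 1; push_cast; ring
    rw [Real.cosh_eq, e1, e2, e3]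
    have := Real.exp_pos (-t)
    field_simp
  rw [sechSqrt, h1, Real.mul_rpow (by positivity) (by positivity),
    Real.mul_rpow (by positivity) (by positivity), ← Real.sqrt_eq_rpow, ← Real.sqrt_eq_rpow,
    Real.sqrt_sq (Real.exp_pos _).le, Real.inv_rpow (by positivity), Real.rpow_neg (by positivity)]

theorem hasDerivAt_sechSqrt (t : ℝ) :
    HasDerivAt sechSqrt (-Real.tanh (2 * t) * sechSqrt t) t := by
  have hc := Real.cosh_pos (2 * t)
  have h1 : HasDerivAt (fun t : ℝ => 1 / Real.cosh (2 * t))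
      (-(Real.sinh (2 * t) * 2) / Real.cosh (2 * t) ^ 2) t := by
    have h : HasDerivAt (fun t : ℝ => Real.cosh (2 * t)) (Real.sinh (2 * t) * 2) t := by
      refine HasDerivAt.cosh ?_
      simpa using (hasDerivAt_id t).const_mul 2
    simpa only [one_div] using h.fun_inv hc.ne'
  have h2 := h1.rpow_const (p := 1 / 2) (Or.inl (one_div_pos.2 hc).ne')
  convert! h2 using 1
  rw [sechSqrt, Real.rpow_sub_one (one_div_pos.2 hc).ne', Real.tanh_eq_sinh_div_cosh]
  field_simp

theorem hasDerivAt_tanh_mul_sechSqrt (t : ℝ) :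
    HasDerivAt (fun t => -Real.tanh (2 * t) * sechSqrt t)
      ((1 - 3 / Real.cosh (2 * t) ^ 2) * sechSqrt t) t := by
  have hc := Real.cosh_pos (2 * t)
  have h1 : HasDerivAt (fun t : ℝ => Real.tanh (2 * t)) (2 / Real.cosh (2 * t) ^ 2) t := by
    have hs : HasDerivAt (fun t : ℝ => Real.sinh (2 * t)) (Real.cosh (2 * t) * 2) t := by
      refine HasDerivAt.sinh ?_
      simpa using (hasDerivAt_id t).const_mul 2
    have h : HasDerivAt (fun t : ℝ => Real.cosh (2 * t)) (Real.sinh (2 * t) * 2) t := by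
      refine HasDerivAt.cosh ?_
      simpa using (hasDerivAt_id t).const_mul 2
    have e : (fun t : ℝ => Real.tanh (2 * t)) = fun t => Real.sinh (2 * t) / Real.cosh (2 * t) :=
      funext fun t => Real.tanh_eq_sinh_div_cosh _
    rw [e]
    convert! hs.div h hc.ne' using 1
    have := Real.cosh_sq (2 * t)
    congr 1
    linear_combination -2 * this
  convert! h1.fun_neg.fun_mul (hasDerivAt_sechSqrt t) using 1
  rw [Real.tanh_eq_sinh_div_cosh]
  have := Real.cosh_sq (2 * t)
  field_simp
  linear_combination sechSqrt t * this

theorem continuous_sechSqrt : Continuous sechSqrt :=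
  continuous_iff_continuousAt.2 fun t => (hasDerivAt_sechSqrt t).continuousAt

theorem integrable_sechSqrt : Integrable sechSqrt := by
  have h : IntegrableOn (fun t : ℝ => √2 * Real.exp (-t)) (Set.Ioi 0) :=
    (integrableOn_exp_neg_Ioi 0).const_mul _
  have h1 : IntegrableOn sechSqrt (Set.Ioi 0) := by
    refine h.mono' continuous_sechSqrt.aestronglyMeasurable (Eventually.of_forall fun t => ?_)
    rw [Real.norm_eq_abs, abs_of_pos (sechSqrt_pos t), sechSqrt_eq]
    refine mul_le_of_le_one_right (by positivity) ?_
    exact Real.rpow_le_one_of_one_le_of_nonpos (by linarith [Real.exp_pos (-(4 * t))]) (by norm_num)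
  have h2 : IntegrableOn sechSqrt (Set.Iic 0) := by
    have h0 : IntegrableOn sechSqrt (Set.Ici (-0)) := by
      rw [neg_zero]
      exact (integrableOn_Ici_iff_integrableOn_Ioi (by simp)).2 h1
    have h3 := h0.comp_neg_Iic
    simpa only [sechSqrt_neg, neg_zero] using h3
  rw [← integrableOn_univ, ← Set.Iic_union_Ioi (a := (0 : ℝ))]
  exact h2.union h1

/-- `(sech 2t)^(1/2)` as a complex-valued function. -/
noncomputable def sechSqrtC (t : ℝ) : ℂ := (sechSqrt t : ℂ)

theorem integrable_sechSqrtC : Integrable sechSqrtC := integrable_sechSqrt.ofReal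

theorem continuous_sechSqrtC : Continuous sechSqrtC := Complex.continuous_ofReal.comp continuous_sechSqrt

theorem deriv_sechSqrtC :
    deriv sechSqrtC = fun t => ((-Real.tanh (2 * t) * sechSqrt t : ℝ) : ℂ) :=
  funext fun t => (hasDerivAt_sechSqrt t).ofReal_comp.deriv

theorem deriv_deriv_sechSqrtC : deriv (deriv sechSqrtC) =
    fun t => (((1 - 3 / Real.cosh (2 * t) ^ 2) * sechSqrt t : ℝ) : ℂ) := by
  rw [deriv_sechSqrtC]
  exact funext fun t => (hasDerivAt_tanh_mul_sechSqrt t).ofReal_comp.deriv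

theorem integrable_bdd_mul_sechSqrt {g : ℝ → ℝ} (hg : Continuous g) {c : ℝ} (hc : ∀ t, |g t| ≤ c) :
    Integrable fun t => ((g t * sechSqrt t : ℝ) : ℂ) :=
  (integrable_sechSqrt.bdd_mul hg.aestronglyMeasurable (Eventually.of_forall hc)).ofReal

theorem norm_fourier_le_integral_norm (f : ℝ → ℂ) (w : ℝ) : ‖𝓕 f w‖ ≤ ∫ v, ‖f v‖ :=
  VectorFourier.norm_fourierIntegral_le_integral_norm _ _ _ _ _

theorem continuous_fourier_sechSqrtC : Continuous (𝓕 sechSqrtC) :=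
  VectorFourier.fourierIntegral_continuous Real.continuous_fourierChar (by fun_prop)
    integrable_sechSqrtC

/-- The Fourier transform is `O(1/w²)`, since the second derivative is integrable. -/
theorem integrable_fourier_sechSqrtC : Integrable (𝓕 sechSqrtC) := by
  have hd1 : Differentiable ℝ sechSqrtC := fun t => (hasDerivAt_sechSqrt t).ofReal_comp.differentiableAt
  have hd2 : Differentiable ℝ (deriv sechSqrtC) := by
    rw [deriv_sechSqrtC]
    exact fun t => (hasDerivAt_tanh_mul_sechSqrt t).ofReal_comp.differentiableAt
  have hi1 : Integrable (deriv sechSqrtC) := by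
    rw [deriv_sechSqrtC]
    refine integrable_bdd_mul_sechSqrt (c := 1) (g := fun t => -Real.tanh (2 * t)) ?_ fun t => ?_
    · simp only [Real.tanh_eq_sinh_div_cosh]
      exact (Continuous.div (by fun_prop) (by fun_prop) fun t => (Real.cosh_pos _).ne').neg
    · rw [abs_neg]
      exact (Real.abs_tanh_lt_one _).le
  have hi2 : Integrable (deriv (deriv sechSqrtC)) := by
    rw [deriv_deriv_sechSqrtC]
    refine integrable_bdd_mul_sechSqrt (c := 2)
      (g := fun t => 1 - 3 / Real.cosh (2 * t) ^ 2) ?_ fun t => ?_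
    · refine continuous_const.sub (continuous_const.div (by fun_prop) fun t => ?_)
      exact pow_ne_zero _ (Real.cosh_pos _).ne'
    · have h1 : 1 ≤ Real.cosh (2 * t) ^ 2 := one_le_pow₀ (Real.one_le_cosh _)
      have h2 : 3 / Real.cosh (2 * t) ^ 2 ≤ 3 := div_le_self (by norm_num) h1
      have h3 : 0 ≤ 3 / Real.cosh (2 * t) ^ 2 := by positivity
      rw [abs_le]
      constructor <;> linarith
  have e1 := Real.fourier_deriv integrable_sechSqrtC hd1 hi1
  have e2 := Real.fourier_deriv hi1 hd2 hi2
  set C₁ := ∫ v, ‖sechSqrtC v‖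
  set C₂ := ∫ v, ‖deriv (deriv sechSqrtC) v‖
  refine (integrable_inv_one_add_sq.const_mul (C₁ + C₂)).mono'
    continuous_fourier_sechSqrtC.aestronglyMeasurable (Eventually.of_forall fun w => ?_)
  have h1 := norm_fourier_le_integral_norm sechSqrtC w
  have h2 := norm_fourier_le_integral_norm (deriv (deriv sechSqrtC)) w
  have h3 : ‖𝓕 (deriv (deriv sechSqrtC)) w‖ = (2 * Real.pi * |w|) ^ 2 * ‖𝓕 sechSqrtC w‖ := by
    rw [e2, e1]
    simp only [smul_eq_mul, norm_mul, Complex.norm_real, Complex.norm_I, Real.norm_eq_abs,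
      abs_of_pos Real.pi_pos, Complex.norm_ofNat]
    ring
  rw [h3, mul_pow, sq_abs] at h2
  have h4 : 1 ≤ (2 * Real.pi) ^ 2 := one_le_pow₀ (by linarith [Real.pi_gt_three])
  rw [← div_eq_mul_inv, le_div_iff₀ (by positivity)]
  have h5 : w ^ 2 * ‖𝓕 sechSqrtC w‖ ≤ C₂ := by
    refine le_trans ?_ h2
    rw [mul_assoc]
    exact le_mul_of_one_le_left (by positivity) h4
  linarith

/-- The density of the spectral measure of the vacuum, `(2π)⁻¹ ∫ e^(-ilx) (sech 2x)^(1/2) dx`. -/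
noncomputable def vacuumDensity (l : ℝ) : ℂ :=
  (1 / (2 * Real.pi) : ℝ) * 𝓕 sechSqrtC (l / (2 * Real.pi))

theorem vacuumDensity_eq (l : ℝ) : vacuumDensity l =
    (1 / (2 * Real.pi) : ℝ) * ∫ x : ℝ, Complex.exp (-(Complex.I * l * x)) * sechSqrtC x := by
  rw [vacuumDensity, Real.fourier_real_eq_integral_exp_smul]
  congr 2
  funext x
  rw [smul_eq_mul]
  congr 2
  have := Real.pi_ne_zero
  push_cast
  field_simp

theorem integrable_vacuumDensity : Integrable vacuumDensity :=
  (integrable_fourier_sechSqrtC.comp_div (by have := Real.pi_pos; positivity)).const_mul _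

theorem integral_exp_mul_vacuumDensity (t : ℝ) :
    ∫ l : ℝ, Complex.exp (t * l * Complex.I) * vacuumDensity l = (sechSqrt t : ℂ) := by
  have h1 := congrFun (continuous_sechSqrtC.fourierInv_fourier_eq integrable_sechSqrtC
    integrable_fourier_sechSqrtC) t
  rw [Real.fourierInv_eq'] at h1
  have hpi : 0 < 2 * Real.pi := by have := Real.pi_pos; positivity
  have h2 := Measure.integral_comp_div (fun w : ℝ => ((1 / (2 * Real.pi) : ℝ) : ℂ) *
    (Complex.exp (((2 * Real.pi * inner ℝ w t : ℝ) : ℂ) * Complex.I) • 𝓕 sechSqrtC w)) (2 * Real.pi)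
  rw [integral_const_mul _ fun w : ℝ => Complex.exp (((2 * Real.pi * inner ℝ w t : ℝ) : ℂ) *
    Complex.I) • 𝓕 sechSqrtC w, h1, abs_of_pos hpi] at h2
  have h3 : (2 * Real.pi) • (((1 / (2 * Real.pi) : ℝ) : ℂ) * sechSqrtC t) = (sechSqrt t : ℂ) := by
    rw [Complex.real_smul, ← mul_assoc, ← Complex.ofReal_mul, mul_one_div_cancel hpi.ne']
    simp [sechSqrtC]
  rw [h3] at h2
  rw [← h2]
  congr 1
  funext l
  rw [vacuumDensity, smul_eq_mul]
  have e : ((2 * Real.pi * inner ℝ (l / (2 * Real.pi)) t : ℝ) : ℂ) = (t : ℂ) * l := by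
    rw [← Complex.ofReal_mul]
    congr 1
    simp
    field_simp
  rw [e]
  ring

theorem conj_vacuumDensity (l : ℝ) : (starRingEnd ℂ) (vacuumDensity l) = vacuumDensity l := by
  rw [vacuumDensity_eq, map_mul, Complex.conj_ofReal, ← integral_conj]
  congr 1
  rw [← integral_neg_eq_self]
  congr 1
  funext x
  rw [map_mul, ← Complex.exp_conj, sechSqrtC, sechSqrtC, sechSqrt_neg, Complex.conj_ofReal]
  congr 2
  simp

/-! ### The density in terms of the incomplete Beta function -/

/-- The substitution `s = e^(-4x)` turns the half-line Fourier integral of `(sech 2x)^(1/2)` into an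
incomplete Beta integral. -/
theorem integral_Ioi_exp_mul_sechSqrtC (t : ℝ) :
    ∫ s in Set.Ioo (0 : ℝ) 1, (s : ℂ) ^ ((1 + Complex.I * t) / 4 - 1) *
        (1 + s : ℂ) ^ ((1 / 2 : ℂ) - 1) =
      (4 / √2 : ℝ) * ∫ x in Set.Ioi (0 : ℝ), Complex.exp (-(Complex.I * t * x)) * sechSqrtC x := by
  have himg : (fun x : ℝ => Real.exp (-(4 * x))) '' Set.Ioi 0 = Set.Ioo 0 1 := by
    ext s
    constructor
    · rintro ⟨x, hx, rfl⟩
      have hx' : 0 < x := hx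
      exact ⟨Real.exp_pos _, Real.exp_lt_one_iff.2 (by linarith)⟩
    · rintro ⟨h0, h1⟩
      refine ⟨-Real.log s / 4, ?_, ?_⟩
      · have := Real.log_neg h0 h1
        simp only [Set.mem_Ioi]
        linarith
      · simp only
        rw [mul_div_cancel₀ _ (by norm_num : (4 : ℝ) ≠ 0), neg_neg, Real.exp_log h0]
  have hderiv : ∀ x ∈ Set.Ioi (0 : ℝ), HasDerivWithinAt (fun x : ℝ => Real.exp (-(4 * x)))
      (Real.exp (-(4 * x)) * (-4)) (Set.Ioi 0) x := by
    intro x _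
    refine HasDerivAt.hasDerivWithinAt (HasDerivAt.exp ?_)
    simpa using ((hasDerivAt_id x).const_mul 4).fun_neg
  have hinj : Set.InjOn (fun x : ℝ => Real.exp (-(4 * x))) (Set.Ioi 0) := by
    intro x _ y _ h
    have := Real.exp_injective h
    linarith
  rw [← himg, integral_image_eq_integral_abs_deriv_smul measurableSet_Ioi hderiv hinj,
    ← integral_const_mul]
  congr 1
  funext x
  have hE := Real.exp_pos (-(4 * x))
  have e1 : ((Real.exp (-(4 * x)) : ℝ) : ℂ) ^ ((1 + Complex.I * t) / 4 - 1) =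
      Complex.exp (-x) * Complex.exp (-(Complex.I * t * x)) * Complex.exp (4 * x) := by
    rw [Complex.cpow_def_of_ne_zero (Complex.ofReal_ne_zero.2 hE.ne'), ← Complex.ofReal_log hE.le,
      Real.log_exp, ← Complex.exp_add, ← Complex.exp_add]
    congr 1
    push_cast
    ring
  have e2 : (1 + (Real.exp (-(4 * x)) : ℝ) : ℂ) ^ ((1 / 2 : ℂ) - 1) =
      (((1 + Real.exp (-(4 * x))) ^ (-(1 / 2) : ℝ) : ℝ) : ℂ) := by
    rw [Complex.ofReal_cpow (by positivity)]
    push_cast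
    norm_num
  have e3 : |Real.exp (-(4 * x)) * (-4)| = 4 * Real.exp (-(4 * x)) := by
    rw [abs_mul, abs_of_pos hE]
    norm_num
    ring
  have e4 : ((Real.exp (-(4 * x)) : ℝ) : ℂ) * Complex.exp (4 * x) = 1 := by
    rw [Complex.ofReal_exp, ← Complex.exp_add]
    simp
  have e5 : ((√2 : ℝ) : ℂ) ≠ 0 := by simp
  rw [e1, e2, e3, sechSqrtC, sechSqrt_eq, Complex.real_smul]
  push_cast at e4 ⊢
  field_simp
  linear_combination ((((1 + Real.exp (-(4 * x))) ^ (-(1 / 2) : ℝ) : ℝ) : ℂ)) * e4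

theorem incompleteBeta_neg_one (a b : ℂ) :
    incompleteBeta (-1) a b = Complex.exp (Real.pi * Complex.I * a) *
      ∫ s in Set.Ioo (0 : ℝ) 1, (s : ℂ) ^ (a - 1) * (1 + s : ℂ) ^ (b - 1) := by
  rw [incompleteBeta, intervalIntegral.integral_of_le zero_le_one, integral_Ioc_eq_integral_Ioo,
    ← integral_const_mul]
  refine setIntegral_congr_fun measurableSet_Ioo fun s hs => ?_
  have e : (-1 : ℂ) ^ (a - 1) = -Complex.exp (Real.pi * Complex.I * a) := by
    rw [Complex.cpow_def_of_ne_zero (by norm_num), Complex.log_neg_one, mul_sub, mul_one,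
      Complex.exp_sub, Complex.exp_pi_mul_I]
    ring
  rw [mul_ofReal_cpow (by norm_num) hs.1, e]
  ring_nf

theorem integral_exp_mul_sechSqrtC_split (t : ℝ) :
    ∫ x : ℝ, Complex.exp (-(Complex.I * t * x)) * sechSqrtC x =
      (∫ x in Set.Ioi (0 : ℝ), Complex.exp (-(Complex.I * t * x)) * sechSqrtC x) +
        ∫ x in Set.Ioi (0 : ℝ), Complex.exp (-(Complex.I * (-t : ℝ) * x)) * sechSqrtC x := by
  have hint : Integrable fun x : ℝ => Complex.exp (-(Complex.I * t * x)) * sechSqrtC x := by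
    refine integrable_sechSqrtC.bdd_mul (c := 1) (by fun_prop) (Eventually.of_forall fun x => ?_)
    have : -(Complex.I * t * x) = ((-(t * x) : ℝ) : ℂ) * Complex.I := by push_cast; ring
    rw [this, Complex.norm_exp_ofReal_mul_I]
  have h := integral_comp_neg_Ioi 0
    (fun x : ℝ => Complex.exp (-(Complex.I * t * x)) * sechSqrtC x)
  rw [neg_zero] at h
  rw [← intervalIntegral.integral_Iic_add_Ioi hint.integrableOn hint.integrableOn (b := 0), ← h,
    add_comm]
  congr 2
  funext x
  rw [sechSqrtC, sechSqrtC, sechSqrt_neg]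
  push_cast
  ring_nf

theorem vacuumDensity_eq_betaCombination (t : ℝ) :
    vacuumDensity t = (1 - Complex.I) / (8 * Real.pi) * betaCombination t := by
  have h1 := integral_Ioi_exp_mul_sechSqrtC t
  have h2 := integral_Ioi_exp_mul_sechSqrtC (-t)
  have h3 := integral_exp_mul_sechSqrtC_split t
  set J₁ := ∫ x in Set.Ioi (0 : ℝ), Complex.exp (-(Complex.I * t * x)) * sechSqrtC x
  set J₂ := ∫ x in Set.Ioi (0 : ℝ), Complex.exp (-(Complex.I * (-t : ℝ) * x)) * sechSqrtC x
  have hneg : (1 - Complex.I * t) / 4 = (1 + Complex.I * (-t : ℝ)) / 4 := by push_cast; ring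
  rw [vacuumDensity_eq, h3, betaCombination, hneg, incompleteBeta_neg_one, incompleteBeta_neg_one,
    h1, h2]
  have hexp : ∀ t : ℝ, Complex.exp (Real.pi * Complex.I * ((1 + Complex.I * t) / 4)) =
      Complex.exp (Real.pi / 4 * Complex.I) * Complex.exp (-(Real.pi * t) / 4) := by
    intro t
    rw [← Complex.exp_add]
    congr 1
    linear_combination (Real.pi * t / 4 : ℂ) * Complex.I_sq
  have hroot : Complex.exp (Real.pi / 4 * Complex.I) = (√2 / 2 : ℝ) * (1 + Complex.I) := by
    have e : (Real.pi / 4 * Complex.I : ℂ) = ((Real.pi / 4 : ℝ) : ℂ) * Complex.I := by push_cast; ring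
    rw [e, Complex.exp_mul_I, ← Complex.ofReal_cos, ← Complex.ofReal_sin, Real.cos_pi_div_four,
      Real.sin_pi_div_four]
    ring
  have hc : Complex.exp (-(Real.pi * t) / 4) * Complex.exp (Real.pi * t / 4) = 1 := by
    rw [← Complex.exp_add]
    simp [neg_div]
  have hs : ((√2 : ℝ) : ℂ) ≠ 0 := by simp
  have hpi : (Real.pi : ℂ) ≠ 0 := Complex.ofReal_ne_zero.2 Real.pi_ne_zero
  rw [hexp, hexp, hroot]
  push_cast at hc ⊢
  have e6 : -((Real.pi : ℂ) * -t) / 4 = Real.pi * t / 4 := by ring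
  rw [e6]
  generalize Complex.exp (-(Real.pi * t) / 4) = A at hc ⊢
  generalize Complex.exp (Real.pi * t / 4) = B at hc ⊢
  field_simp
  linear_combination (-(4 : ℂ) * (1 - Complex.I) * (1 + Complex.I) * (J₁ + J₂)) * hc +
    (4 * (J₁ + J₂)) * Complex.I_sq

/-! ### Multiplication operators on `L²` -/

theorem aemeasurable_density {α F : Type*} [MeasurableSpace α] {μ : Measure α}
    [NormedAddCommGroup F] (f : Lp F 2 μ) :
    AEMeasurable (fun x => ENNReal.ofReal (‖f x‖ ^ 2)) μ :=
  ((Lp.aestronglyMeasurable f).norm.pow 2).aemeasurable.ennreal_ofReal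

section Multiplication

variable {α F : Type*} [MeasurableSpace α] {μ : Measure α} [NormedAddCommGroup F]
  [InnerProductSpace ℂ F]

theorem memLp_bdd_smul {m : α → ℂ} (hm : Measurable m) {C : ℝ} (hC : ∀ x, ‖m x‖ ≤ C)
    (f : Lp F 2 μ) : MemLp (fun x => m x • f x) 2 μ := by
  refine (Lp.memLp f).of_le_mul (c := C)
    (hm.aestronglyMeasurable.smul (Lp.aestronglyMeasurable f)) (Eventually.of_forall fun x => ?_)
  rw [norm_smul]
  gcongr
  exact hC x

/-- Multiplication by a bounded measurable function, as a bounded operator on `L²`. -/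
noncomputable def mulOp (m : α → ℂ) (hm : Measurable m) (C : ℝ) (hC : ∀ x, ‖m x‖ ≤ C) :
    Lp F 2 μ →L[ℂ] Lp F 2 μ :=
  LinearMap.mkContinuous
    { toFun := fun f => (memLp_bdd_smul hm hC f).toLp _
      map_add' := fun f g => by
        refine Lp.ext ?_
        filter_upwards [(memLp_bdd_smul hm hC (f + g)).coeFn_toLp, Lp.coeFn_add f g,
          Lp.coeFn_add ((memLp_bdd_smul hm hC f).toLp _) ((memLp_bdd_smul hm hC g).toLp _),
          (memLp_bdd_smul hm hC f).coeFn_toLp, (memLp_bdd_smul hm hC g).coeFn_toLp]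
          with x h1 h2 h3 h4 h5
        rw [h1, h2, h3, Pi.add_apply, Pi.add_apply, h4, h5, smul_add]
      map_smul' := fun c f => by
        refine Lp.ext ?_
        filter_upwards [(memLp_bdd_smul hm hC (c • f)).coeFn_toLp, Lp.coeFn_smul c f,
          Lp.coeFn_smul c ((memLp_bdd_smul hm hC f).toLp _),
          (memLp_bdd_smul hm hC f).coeFn_toLp] with x h1 h2 h3 h4
        rw [h1, h2, RingHom.id_apply, h3, Pi.smul_apply, Pi.smul_apply, h4, smul_comm] }
    C fun f => by
      refine Lp.norm_le_mul_norm_of_ae_le_mul ?_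
      filter_upwards [(memLp_bdd_smul hm hC f).coeFn_toLp] with x h1
      simp only [LinearMap.coe_mk, AddHom.coe_mk]
      rw [h1, norm_smul]
      gcongr
      exact hC x

theorem mulOp_coeFn {m : α → ℂ} (hm : Measurable m) {C : ℝ} (hC : ∀ x, ‖m x‖ ≤ C)
    (f : Lp F 2 μ) : mulOp m hm C hC f =ᵐ[μ] fun x => m x • f x :=
  (memLp_bdd_smul hm hC f).coeFn_toLp

theorem inner_mulOp_left {m : α → ℂ} (hm : Measurable m) {C : ℝ} (hC : ∀ x, ‖m x‖ ≤ C)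
    (hreal : ∀ x, (starRingEnd ℂ) (m x) = m x) (f g : Lp F 2 μ) :
    inner ℂ (mulOp m hm C hC f) g = inner ℂ f (mulOp m hm C hC g) := by
  rw [L2.inner_def, L2.inner_def]
  refine integral_congr_ae ?_
  filter_upwards [mulOp_coeFn hm hC f, mulOp_coeFn hm hC g] with x h1 h2
  rw [h1, h2, inner_smul_left, inner_smul_right, hreal]

/-- Strong continuity of multiplication under bounded pointwise convergence of the multipliers. -/
theorem tendsto_mulOp {ι : Type*} {l : Filter ι} [l.IsCountablyGenerated] {m : ι → α → ℂ}
    {m₀ : α → ℂ} {C : ℝ} (hm : ∀ i, Measurable (m i)) (hC : ∀ i x, ‖m i x‖ ≤ C)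
    (hm₀ : Measurable m₀) (hC₀ : ∀ x, ‖m₀ x‖ ≤ C)
    (h : ∀ x, Tendsto (fun i => m i x) l (𝓝 (m₀ x))) (f : Lp F 2 μ) :
    Tendsto (fun i => mulOp (m i) (hm i) C (hC i) f) l (𝓝 (mulOp m₀ hm₀ C hC₀ f)) := by
  rw [tendsto_iff_norm_sub_tendsto_zero]
  have hae : ∀ i, (fun x => ‖(mulOp (m i) (hm i) C (hC i) f - mulOp m₀ hm₀ C hC₀ f) x‖ ^ 2) =ᵐ[μ]
      fun x => ‖(m i x - m₀ x) • f x‖ ^ 2 := by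
    intro i
    filter_upwards [Lp.coeFn_sub (mulOp (m i) (hm i) C (hC i) f) (mulOp m₀ hm₀ C hC₀ f),
      mulOp_coeFn (hm i) (hC i) f, mulOp_coeFn hm₀ hC₀ f] with x h1 h2 h3
    rw [h1, Pi.sub_apply, h2, h3, sub_smul]
  have key : Tendsto (fun i => ‖mulOp (m i) (hm i) C (hC i) f - mulOp m₀ hm₀ C hC₀ f‖ ^ 2) l
      (𝓝 0) := by
    have h0 : ∀ i, ‖mulOp (m i) (hm i) C (hC i) f - mulOp m₀ hm₀ C hC₀ f‖ ^ 2 =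
        ∫ x, ‖(m i x - m₀ x) • f x‖ ^ 2 ∂μ := fun i => by
      rw [norm_sq_eq_integral, integral_congr_ae (hae i)]
    simp only [h0]
    have hz : (0 : ℝ) = ∫ _, (0 : ℝ) ∂μ := by simp
    rw [hz]
    refine tendsto_integral_filter_of_dominated_convergence (fun x => (2 * C) ^ 2 * ‖f x‖ ^ 2)
      (Eventually.of_forall fun i => ?_) (Eventually.of_forall fun i => Eventually.of_forall fun x => ?_)
      ?_ (Eventually.of_forall fun x => ?_)
    · exact (((hm i).sub hm₀).aestronglyMeasurable.smul (Lp.aestronglyMeasurable f)).norm.pow 2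
    · rw [Real.norm_eq_abs, abs_of_nonneg (by positivity), norm_smul, mul_pow]
      have : ‖m i x - m₀ x‖ ≤ 2 * C := (norm_sub_le _ _).trans (by linarith [hC i x, hC₀ x])
      gcongr
    · exact ((memLp_two_iff_integrable_sq_norm (Lp.aestronglyMeasurable f)).1
        (Lp.memLp f)).const_mul _
    · have h1 := ((((h x).sub_const (m₀ x)).smul_const (f x)).norm).pow 2
      simpa using h1
  simpa using key.sqrt

end Multiplication

section Cutoff

variable {α : Type*} {φ : α → ℝ}

/-- The indicator function of `{φ ≤ l}`. -/
noncomputable def cutoff (φ : α → ℝ) (l : ℝ) (x : α) : ℂ := Set.indicator (Set.Iic l) 1 (φ x)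

theorem cutoff_of_le {l : ℝ} {x : α} (h : φ x ≤ l) : cutoff φ l x = 1 :=
  Set.indicator_of_mem (s := Set.Iic l) h _

theorem cutoff_of_lt {l : ℝ} {x : α} (h : l < φ x) : cutoff φ l x = 0 :=
  Set.indicator_of_notMem (s := Set.Iic l) (not_le.2 h) _

theorem measurable_cutoff [MeasurableSpace α] (hφ : Measurable φ) (l : ℝ) : Measurable (cutoff φ l) :=
  (measurable_one.indicator measurableSet_Iic).comp hφ

theorem norm_cutoff_le (l : ℝ) (x : α) : ‖cutoff φ l x‖ ≤ 1 := by
  rcases le_or_gt (φ x) l with h | h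
  · simp [cutoff_of_le h]
  · simp [cutoff_of_lt h]

theorem conj_cutoff (l : ℝ) (x : α) : (starRingEnd ℂ) (cutoff φ l x) = cutoff φ l x := by
  rcases le_or_gt (φ x) l with h | h
  · simp [cutoff_of_le h]
  · simp [cutoff_of_lt h]

theorem cutoff_mul_cutoff {l m : ℝ} (hlm : l ≤ m) (x : α) :
    cutoff φ l x * cutoff φ m x = cutoff φ l x := by
  rcases le_or_gt (φ x) l with h | h
  · simp [cutoff_of_le h, cutoff_of_le (h.trans hlm)]
  · simp [cutoff_of_lt h]

/-- The indicator function of `{|φ| ≤ n}`. -/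
noncomputable def truncation (φ : α → ℝ) (n : ℕ) (x : α) : ℂ :=
  Set.indicator (Set.Icc (-(n : ℝ)) n) 1 (φ x)

theorem truncation_of_le {n : ℕ} {x : α} (h : |φ x| ≤ n) : truncation φ n x = 1 :=
  Set.indicator_of_mem (s := Set.Icc (-(n : ℝ)) n) (abs_le.1 h) _

theorem truncation_of_lt {n : ℕ} {x : α} (h : (n : ℝ) < |φ x|) : truncation φ n x = 0 :=
  Set.indicator_of_notMem (s := Set.Icc (-(n : ℝ)) n) (fun h' => h.not_ge (abs_le.2 h')) _

theorem measurable_truncation [MeasurableSpace α] (hφ : Measurable φ) (n : ℕ) : Measurable (truncation φ n) :=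
  (measurable_one.indicator measurableSet_Icc).comp hφ

theorem norm_truncation_le (n : ℕ) (x : α) : ‖truncation φ n x‖ ≤ 1 := by
  rcases le_or_gt |φ x| n with h | h
  · simp [truncation_of_le h]
  · simp [truncation_of_lt h]

theorem conj_truncation (n : ℕ) (x : α) :
    (starRingEnd ℂ) (truncation φ n x) = truncation φ n x := by
  rcases le_or_gt |φ x| n with h | h
  · simp [truncation_of_le h]
  · simp [truncation_of_lt h]

theorem norm_mul_truncation_le (n : ℕ) (x : α) : ‖(φ x : ℂ) * truncation φ n x‖ ≤ n := by
  rcases le_or_gt |φ x| n with h | h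
  · simpa [truncation_of_le h] using h
  · simp [truncation_of_lt h]

end Cutoff

/-! ### Operators diagonalized by a unitary map -/

section Diagonal

variable {H α F : Type*} [NormedAddCommGroup H] [InnerProductSpace ℂ H]
  [MeasurableSpace α] {μ : Measure α} [NormedAddCommGroup F] [InnerProductSpace ℂ F]
  (V : H ≃ₗᵢ[ℂ] Lp F 2 μ) {φ : α → ℝ} (hφ : Measurable φ)

/-- The maximal domain `{f | φ · V f ∈ L²}` of `V⁻¹ φ V`. -/
def diagonalDomain (V : H ≃ₗᵢ[ℂ] Lp F 2 μ) (φ : α → ℝ) : Submodule ℂ H where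
  carrier := {f | MemLp (fun x => (φ x : ℂ) • V f x) 2 μ}
  zero_mem' := by
    refine MemLp.ae_eq ?_ (MemLp.zero (ε := F) (p := 2) (μ := μ))
    rw [map_zero]
    filter_upwards [Lp.coeFn_zero F 2 μ] with x h1
    rw [h1, Pi.zero_apply, smul_zero]
  add_mem' := fun {f g} hf hg => by
    refine MemLp.ae_eq ?_ (MemLp.add hf hg)
    rw [map_add]
    filter_upwards [Lp.coeFn_add (V f) (V g)] with x h1
    rw [h1, Pi.add_apply, Pi.add_apply, smul_add]
  smul_mem' := fun c f hf => by
    refine MemLp.ae_eq ?_ (MemLp.const_smul hf c)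
    rw [map_smul]
    filter_upwards [Lp.coeFn_smul c (V f)] with x h1
    rw [h1, Pi.smul_apply, Pi.smul_apply, smul_comm]

theorem mem_diagonalDomain {f : H} :
    f ∈ diagonalDomain V φ ↔ MemLp (fun x => (φ x : ℂ) • V f x) 2 μ := Iff.rfl

/-- The operator `V⁻¹ φ V` on its maximal domain. -/
noncomputable def diagonal (V : H ≃ₗᵢ[ℂ] Lp F 2 μ) (φ : α → ℝ) : H →ₗ.[ℂ] H where
  domain := diagonalDomain V φ
  toFun :=
    { toFun := fun f => V.symm (MemLp.toLp _ ((mem_diagonalDomain V).1 f.2))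
      map_add' := fun f g => by
        rw [← map_add, ← MemLp.toLp_add]
        refine congrArg V.symm (MemLp.toLp_congr _ _ ?_)
        rw [Submodule.coe_add, map_add]
        filter_upwards [Lp.coeFn_add (V f) (V g)] with x h1
        rw [h1, Pi.add_apply, Pi.add_apply, smul_add]
      map_smul' := fun c f => by
        rw [RingHom.id_apply, ← map_smul, ← MemLp.toLp_const_smul]
        refine congrArg V.symm (MemLp.toLp_congr _ _ ?_)
        rw [Submodule.coe_smul, map_smul]
        filter_upwards [Lp.coeFn_smul c (V f)] with x h1
        rw [h1, Pi.smul_apply, Pi.smul_apply, smul_comm] }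

theorem mem_diagonal_domain {f : H} :
    f ∈ (diagonal V φ).domain ↔ MemLp (fun x => (φ x : ℂ) • V f x) 2 μ := Iff.rfl

theorem map_diagonal_coeFn (f : (diagonal V φ).domain) :
    V (diagonal V φ f) =ᵐ[μ] fun x => (φ x : ℂ) • V f x := by
  have h : V (diagonal V φ f) = MemLp.toLp _ f.2 := V.apply_symm_apply _
  rw [h]
  exact MemLp.coeFn_toLp _

/-- The bounded operator `V⁻¹ m V`. -/
noncomputable def conjMulOp (m : α → ℂ) (hm : Measurable m) (C : ℝ) (hC : ∀ x, ‖m x‖ ≤ C) :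
    H →L[ℂ] H :=
  (V.symm.toContinuousLinearEquiv : Lp F 2 μ →L[ℂ] H) ∘L mulOp m hm C hC ∘L
    (V.toContinuousLinearEquiv : H →L[ℂ] Lp F 2 μ)

theorem conjMulOp_apply (m : α → ℂ) (hm : Measurable m) (C : ℝ) (hC : ∀ x, ‖m x‖ ≤ C) (f : H) :
    conjMulOp V m hm C hC f = V.symm (mulOp m hm C hC (V f)) := rfl

theorem conjMulOp_coeFn (m : α → ℂ) (hm : Measurable m) (C : ℝ) (hC : ∀ x, ‖m x‖ ≤ C) (f : H) :
    V (conjMulOp V m hm C hC f) =ᵐ[μ] fun x => m x • V f x := by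
  rw [conjMulOp_apply, V.apply_symm_apply]
  exact mulOp_coeFn hm hC _

theorem inner_conjMulOp_left {m : α → ℂ} (hm : Measurable m) {C : ℝ} (hC : ∀ x, ‖m x‖ ≤ C)
    (hreal : ∀ x, (starRingEnd ℂ) (m x) = m x) (f g : H) :
    inner ℂ (conjMulOp V m hm C hC f) g = inner ℂ f (conjMulOp V m hm C hC g) := by
  rw [← V.inner_map_map, ← V.inner_map_map f, conjMulOp_apply, conjMulOp_apply,
    V.apply_symm_apply, V.apply_symm_apply, inner_mulOp_left hm hC hreal]

theorem tendsto_conjMulOp {ι : Type*} {l : Filter ι} [l.IsCountablyGenerated] {m : ι → α → ℂ}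
    {m₀ : α → ℂ} {C : ℝ} (hm : ∀ i, Measurable (m i)) (hC : ∀ i x, ‖m i x‖ ≤ C)
    (hm₀ : Measurable m₀) (hC₀ : ∀ x, ‖m₀ x‖ ≤ C)
    (h : ∀ x, Tendsto (fun i => m i x) l (𝓝 (m₀ x))) (f : H) :
    Tendsto (fun i => conjMulOp V (m i) (hm i) C (hC i) f) l
      (𝓝 (conjMulOp V m₀ hm₀ C hC₀ f)) :=
  (V.symm.continuous.tendsto _).comp (tendsto_mulOp hm hC hm₀ hC₀ h (V f))

theorem conjMulOp_one (hm : Measurable fun _ : α => (1 : ℂ)) {C : ℝ}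
    (hC : ∀ _ : α, ‖(1 : ℂ)‖ ≤ C) (f : H) : conjMulOp V (fun _ => 1) hm C hC f = f := by
  refine V.injective (Lp.ext ?_)
  filter_upwards [conjMulOp_coeFn V _ hm C hC f] with x h1
  rw [h1, one_smul]

theorem conjMulOp_zero (hm : Measurable fun _ : α => (0 : ℂ)) {C : ℝ}
    (hC : ∀ _ : α, ‖(0 : ℂ)‖ ≤ C) (f : H) : conjMulOp V (fun _ => 0) hm C hC f = 0 := by
  refine V.injective (Lp.ext ?_)
  rw [map_zero]
  filter_upwards [conjMulOp_coeFn V _ hm C hC f, Lp.coeFn_zero F 2 μ] with x h1 h2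
  rw [h1, h2, zero_smul, Pi.zero_apply]

include hφ in
theorem mem_diagonal_domain_iff (f : H) : f ∈ (diagonal V φ).domain ↔
    Integrable (fun x => ‖V f x‖ ^ 2 * φ x ^ 2) μ := by
  have hm : AEStronglyMeasurable (fun x => (φ x : ℂ) • V f x) μ :=
    (Complex.measurable_ofReal.comp hφ).aestronglyMeasurable.smul (Lp.aestronglyMeasurable _)
  rw [mem_diagonal_domain, memLp_two_iff_integrable_sq_norm hm]
  refine integrable_congr (Eventually.of_forall fun x => ?_)
  simp only [norm_smul, Complex.norm_real, Real.norm_eq_abs, mul_pow, sq_abs]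
  ring

theorem truncation_mem_domain (n : ℕ) (f : H) :
    conjMulOp V _ (measurable_truncation hφ n) 1 (norm_truncation_le n) f ∈
      (diagonal V φ).domain := by
  rw [mem_diagonal_domain]
  refine MemLp.ae_eq ?_ (memLp_bdd_smul ((Complex.measurable_ofReal.comp hφ).mul
    (measurable_truncation hφ n)) (norm_mul_truncation_le n) (V f))
  filter_upwards [conjMulOp_coeFn V _ (measurable_truncation hφ n) 1 (norm_truncation_le n) f]
    with x h1
  rw [h1, smul_smul]
  rfl

include hφ in
theorem dense_diagonal_domain : Dense ((diagonal V φ).domain : Set H) := by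
  intro f
  have h := tendsto_conjMulOp V (l := atTop) (fun n => measurable_truncation hφ n)
    norm_truncation_le (m₀ := fun _ => 1) measurable_const (by simp) (fun x => ?_) f
  · rw [conjMulOp_one] at h
    exact mem_closure_of_tendsto h (Eventually.of_forall fun n => truncation_mem_domain V hφ n f)
  · refine tendsto_const_nhds.congr' ?_
    obtain ⟨N, hN⟩ := exists_nat_ge |φ x|
    filter_upwards [eventually_ge_atTop N] with m hm
    rw [truncation_of_le (hN.trans (Nat.cast_le.2 hm))]

variable [CompleteSpace H]

/-- The spectral resolution of `V⁻¹ φ V`: `E_l` is multiplication by the indicator of `{φ ≤ l}`. -/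
noncomputable def diagonalResolution : ResolutionOfIdentity H where
  proj l := conjMulOp V (cutoff φ l) (measurable_cutoff hφ l) 1 (norm_cutoff_le l)
  isStarProjection l := by
    constructor
    · ext f
      refine V.injective (Lp.ext ?_)
      rw [mul_apply_eq_comp]
      filter_upwards [conjMulOp_coeFn V _ (measurable_cutoff hφ l) 1 (norm_cutoff_le l) f,
        conjMulOp_coeFn V _ (measurable_cutoff hφ l) 1 (norm_cutoff_le l)
          (conjMulOp V _ (measurable_cutoff hφ l) 1 (norm_cutoff_le l) f)] with x h1 h2
      rw [h2, h1, smul_smul, cutoff_mul_cutoff le_rfl]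
    · rw [ContinuousLinearMap.isSelfAdjoint_iff_isSymmetric]
      exact fun f g => inner_conjMulOp_left V _ _ (conj_cutoff l) f g
  mul_eq_of_le l m hlm := by
    ext f
    refine V.injective (Lp.ext ?_)
    rw [mul_apply_eq_comp]
    filter_upwards [conjMulOp_coeFn V _ (measurable_cutoff hφ m) 1 (norm_cutoff_le m) f,
      conjMulOp_coeFn V _ (measurable_cutoff hφ l) 1 (norm_cutoff_le l) f,
      conjMulOp_coeFn V _ (measurable_cutoff hφ l) 1 (norm_cutoff_le l)
        (conjMulOp V _ (measurable_cutoff hφ m) 1 (norm_cutoff_le m) f)] with x h1 h2 h3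
    rw [h3, h1, h2, smul_smul, cutoff_mul_cutoff hlm]
  right_continuous f l := by
    refine tendsto_conjMulOp V _ _ _ _ (fun x => ?_) f
    refine tendsto_const_nhds.congr' ?_
    rcases le_or_gt (φ x) l with h | h
    · filter_upwards [self_mem_nhdsWithin] with m hm
      rw [cutoff_of_le h, cutoff_of_le (h.trans hm)]
    · filter_upwards [mem_nhdsWithin_of_mem_nhds (Iio_mem_nhds h)] with m hm
      rw [cutoff_of_lt h, cutoff_of_lt hm]
  tendsto_atBot f := by
    have h := tendsto_conjMulOp V (l := atBot) (fun l => measurable_cutoff hφ l) norm_cutoff_le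
      (m₀ := fun _ => 0) measurable_const (by simp) (fun x => ?_) f
    · rwa [conjMulOp_zero] at h
    · refine tendsto_const_nhds.congr' ?_
      filter_upwards [eventually_lt_atBot (φ x)] with m hm
      rw [cutoff_of_lt hm]
  tendsto_atTop f := by
    have h := tendsto_conjMulOp V (l := atTop) (fun l => measurable_cutoff hφ l) norm_cutoff_le
      (m₀ := fun _ => 1) measurable_const (by simp) (fun x => ?_) f
    · rwa [conjMulOp_one] at h
    · refine tendsto_const_nhds.congr' ?_
      filter_upwards [eventually_ge_atTop (φ x)] with m hm
      rw [cutoff_of_le hm]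

/-- The spectral measure of `f` is the image under `φ` of the measure with density `|V f|²`. -/
theorem measure_diagonalResolution (f : H) :
    (diagonalResolution V hφ).measure f =
      (μ.withDensity fun x => ENNReal.ofReal (‖V f x‖ ^ 2)).map φ := by
  have hi := (memLp_two_iff_integrable_sq_norm (Lp.aestronglyMeasurable (V f))).1 (Lp.memLp (V f))
  refine Measure.ext_of_Iic _ _ fun l => ?_
  have hs : MeasurableSet (φ ⁻¹' Set.Iic l) := hφ measurableSet_Iic
  rw [ResolutionOfIdentity.measure_Iic, Measure.map_apply hφ measurableSet_Iic,
    withDensity_apply _ hs, ← ofReal_integral_eq_lintegral_ofReal hi.integrableOn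
      (Eventually.of_forall fun x => by positivity), ← V.norm_map, norm_sq_eq_integral,
    ← integral_indicator hs]
  congr 1
  refine integral_congr_ae ?_
  filter_upwards [conjMulOp_coeFn V _ (measurable_cutoff hφ l) 1 (norm_cutoff_le l) f] with x h1
  change ‖V (conjMulOp V _ (measurable_cutoff hφ l) 1 (norm_cutoff_le l) f) x‖ ^ 2 = _
  rw [h1]
  rcases le_or_gt (φ x) l with h | h
  · rw [Set.indicator_of_mem (by exact h), cutoff_of_le h, one_smul]
  · rw [Set.indicator_of_notMem (by exact not_le.2 h), cutoff_of_lt h, zero_smul]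
    simp

theorem integral_diagonalResolution {g : ℝ → ℂ} (hg : Measurable g) (f : H) :
    ∫ l, g l ∂(diagonalResolution V hφ).measure f = ∫ x, ((‖V f x‖ ^ 2 : ℝ) : ℂ) * g (φ x) ∂μ := by
  rw [measure_diagonalResolution, integral_map hφ.aemeasurable hg.aestronglyMeasurable,
    integral_withDensity_eq_integral_toReal_smul₀ (aemeasurable_density _)
      (Eventually.of_forall fun x => ENNReal.ofReal_lt_top)]
  congr 1
  funext x
  rw [ENNReal.toReal_ofReal (by positivity), Complex.real_smul]

theorem isExp_diagonalResolution (t : ℝ) :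
    ∃ U : H →L[ℂ] H, (diagonalResolution V hφ).IsExp t U := by
  have hm : Measurable fun x => Complex.exp (Complex.I * t * φ x) := by fun_prop
  refine ⟨conjMulOp V _ hm 1 fun x => (norm_exp_I_mul t (φ x)).le, fun f => ?_⟩
  rw [integral_diagonalResolution V hφ (by fun_prop), ← V.inner_map_map, L2.inner_def]
  refine integral_congr_ae ?_
  filter_upwards [conjMulOp_coeFn V _ hm 1
    (fun x => (norm_exp_I_mul t (φ x)).le) f] with x h1
  rw [h1, inner_smul_right, inner_self_eq_norm_sq_to_K, mul_comm]
  simp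

theorem isResolutionOf_diagonal : (diagonalResolution V hφ).IsResolutionOf (diagonal V φ) := by
  refine ⟨fun f => ?_, fun f => ?_⟩
  · rw [mem_diagonal_domain_iff V hφ, measure_diagonalResolution,
      integrable_map_measure (by fun_prop) hφ.aemeasurable,
      integrable_withDensity_iff_integrable_smul₀' (aemeasurable_density _)
        (Eventually.of_forall fun x => ENNReal.ofReal_lt_top)]
    refine integrable_congr (Eventually.of_forall fun x => ?_)
    simp only [Function.comp_apply, smul_eq_mul]
    rw [ENNReal.toReal_ofReal (by positivity)]
  · rw [integral_diagonalResolution V hφ (by fun_prop), ← V.inner_map_map, L2.inner_def]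
    refine integral_congr_ae ?_
    filter_upwards [map_diagonal_coeFn V f] with x h1
    rw [h1, inner_smul_right, inner_self_eq_norm_sq_to_K, mul_comm]
    simp

include hφ in
/-- Multiplication by a real function is self-adjoint on its maximal domain: testing `⟨T†y, x⟩ =
⟨y, Tx⟩` on vectors cut off to `{|φ| ≤ n}` gives `V T†y = φ V y`. -/
theorem isSelfAdjoint_diagonal : IsSelfAdjoint (diagonal V φ) := by
  have hd := dense_diagonal_domain V hφ
  have hsymm : (diagonal V φ).IsFormalAdjoint (diagonal V φ) := by
    intro f g
    rw [← V.inner_map_map, ← V.inner_map_map (f : H), L2.inner_def, L2.inner_def]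
    refine integral_congr_ae ?_
    filter_upwards [map_diagonal_coeFn V f, map_diagonal_coeFn V g] with x h1 h2
    rw [h1, h2, inner_smul_left, inner_smul_right, Complex.conj_ofReal]
  have hle := hsymm.le_adjoint hd
  rw [LinearPMap.isSelfAdjoint_def]
  refine (LinearPMap.eq_of_le_of_domain_eq hle (le_antisymm hle.1 fun y hy => ?_)).symm
  set w : H := (diagonal V φ).adjoint ⟨y, hy⟩ with hw
  have hadj : ∀ x : (diagonal V φ).domain, inner ℂ w (x : H) = inner ℂ y (diagonal V φ x) :=
    fun x => LinearPMap.adjoint_isFormalAdjoint hd ⟨y, hy⟩ x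
  have hmeas : ∀ n, Measurable fun x => (φ x : ℂ) * truncation φ n x := fun n =>
    (Complex.measurable_ofReal.comp hφ).mul (measurable_truncation hφ n)
  have hcut : ∀ n : ℕ, ∀ᵐ x ∂μ, truncation φ n x • V w x =
      ((φ x : ℂ) * truncation φ n x) • V y x := by
    intro n
    have h1 : conjMulOp V _ (measurable_truncation hφ n) 1 (norm_truncation_le n) w =
        conjMulOp V _ (hmeas n) n (norm_mul_truncation_le n) y := by
      refine ext_inner_right ℂ fun g => ?_
      rw [inner_conjMulOp_left V _ _ (conj_truncation n), inner_conjMulOp_left V _ _ fun x => by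
          rw [map_mul, conj_truncation, Complex.conj_ofReal],
        hadj ⟨_, truncation_mem_domain V hφ n g⟩]
      congr 1
      refine V.injective (Lp.ext ?_)
      filter_upwards [map_diagonal_coeFn V ⟨_, truncation_mem_domain V hφ n g⟩,
        conjMulOp_coeFn V _ (hmeas n) n (norm_mul_truncation_le n) g,
        conjMulOp_coeFn V _ (measurable_truncation hφ n) 1 (norm_truncation_le n) g] with x h1 h2 h3
      rw [h1, h2, h3, smul_smul]
    have h2 := conjMulOp_coeFn V _ (measurable_truncation hφ n) 1 (norm_truncation_le n) w
    rw [h1] at h2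
    filter_upwards [h2, conjMulOp_coeFn V _ (hmeas n) n (norm_mul_truncation_le n) y] with x h3 h4
    rw [← h3, h4]
  rw [mem_diagonal_domain]
  refine MemLp.ae_eq ?_ (Lp.memLp (V w))
  filter_upwards [ae_all_iff.2 hcut] with x hx
  obtain ⟨N, hN⟩ := exists_nat_ge |φ x|
  simpa [truncation_of_le hN] using hx N

end Diagonal

/-! ### Logarithmic coordinates on the two half-lines -/

/-- The substitutions `x = ±e^y` on the two half-lines. -/
theorem lintegral_eq_lintegral_exp {G : ℝ → ENNReal} (hG : Measurable G) :
    ∫⁻ x, G x = ∫⁻ y, ENNReal.ofReal (Real.exp y) * (G (Real.exp y) + G (-Real.exp y)) := by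
  have h1 : ∫⁻ x in Set.Ioi 0, G x = ∫⁻ y, ENNReal.ofReal (Real.exp y) * G (Real.exp y) := by
    have h := lintegral_image_eq_lintegral_abs_deriv_mul (s := Set.univ) (f := Real.exp)
      (f' := Real.exp) MeasurableSet.univ (fun x _ => (Real.hasDerivAt_exp x).hasDerivWithinAt)
      Real.exp_injective.injOn G
    rw [Set.image_univ, Real.range_exp, setLIntegral_univ] at h
    simpa only [Real.abs_exp] using h
  have h2 : ∫⁻ x in Set.Iio 0, G x = ∫⁻ y, ENNReal.ofReal (Real.exp y) * G (-Real.exp y) := by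
    have h := lintegral_image_eq_lintegral_abs_deriv_mul (s := Set.univ) (f := fun y => -Real.exp y)
      (f' := fun y => -Real.exp y) MeasurableSet.univ
      (fun x _ => (Real.hasDerivAt_exp x).neg.hasDerivWithinAt)
      (neg_injective.comp Real.exp_injective).injOn G
    have e : Set.range (fun y : ℝ => -Real.exp y) = Set.Iio 0 := by
      ext x
      constructor
      · rintro ⟨y, rfl⟩
        exact neg_lt_zero.2 (Real.exp_pos y)
      · intro hx
        refine ⟨Real.log (-x), ?_⟩
        change -Real.exp (Real.log (-x)) = x
        rw [Real.exp_log (neg_pos.2 hx), neg_neg]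
    rw [Set.image_univ, e, setLIntegral_univ] at h
    simpa only [abs_neg, Real.abs_exp] using h
  have hIic : ∫⁻ x in Set.Iic 0, G x = ∫⁻ x in Set.Iio 0, G x :=
    setLIntegral_congr Iio_ae_eq_Iic.symm
  have h3 := lintegral_add_compl (μ := volume) G (measurableSet_Iic (a := (0 : ℝ)))
  rw [Set.compl_Iic, hIic, h1, h2] at h3
  have hm : Measurable fun y => ENNReal.ofReal (Real.exp y) * G (-Real.exp y) := by fun_prop
  rw [← h3, ← lintegral_add_left hm]
  simp only [mul_add, add_comm]

theorem ae_comp_exp {p : ℝ → Prop} (h : ∀ᵐ x, p x) :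
    ∀ᵐ y, p (Real.exp y) ∧ p (-Real.exp y) := by
  obtain ⟨t, hts, htm, ht0⟩ := exists_measurable_superset_of_null h
  have h1 := lintegral_eq_lintegral_exp (measurable_one.indicator (f := (1 : ℝ → ENNReal)) htm)
  have hm : Measurable fun y => ENNReal.ofReal (Real.exp y) *
      (t.indicator (1 : ℝ → ENNReal) (Real.exp y) + t.indicator (1 : ℝ → ENNReal) (-Real.exp y)) := by
    have := measurable_one.indicator (f := (1 : ℝ → ENNReal)) htm
    fun_prop
  rw [lintegral_indicator_one htm, ht0, eq_comm, lintegral_eq_zero_iff hm] at h1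
  filter_upwards [h1] with y hy
  have hne : ENNReal.ofReal (Real.exp y) ≠ 0 := by simpa using Real.exp_pos y
  have hy' := (mul_eq_zero.1 hy).resolve_left hne
  rw [add_eq_zero] at hy'
  constructor
  · by_contra hp
    have : Real.exp y ∈ t := hts hp
    simp [Set.indicator_of_mem this] at hy'
  · by_contra hp
    have : -Real.exp y ∈ t := hts hp
    simp [Set.indicator_of_mem this] at hy'

/-- The space `ℂ²` of the pairs of values of a function on the two half-lines. -/
abbrev Pair : Type := EuclideanSpace ℂ (Fin 2)

/-- The function `y ↦ e^(y/2) (f(e^y), f(-e^y))`. -/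
noncomputable def logPair (f : ℝ → ℂ) (y : ℝ) : Pair :=
  ((Real.exp (y / 2) : ℝ) : ℂ) • (f (Real.exp y) • EuclideanSpace.single 0 1 +
    f (-Real.exp y) • EuclideanSpace.single 1 1)

theorem enorm_logPair_sq (f : ℝ → ℂ) (y : ℝ) : ‖logPair f y‖ₑ ^ 2 =
    ENNReal.ofReal (Real.exp y) * (‖f (Real.exp y)‖ₑ ^ 2 + ‖f (-Real.exp y)‖ₑ ^ 2) := by
  have h : ‖logPair f y‖ ^ 2 = Real.exp y * (‖f (Real.exp y)‖ ^ 2 + ‖f (-Real.exp y)‖ ^ 2) := by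
    rw [logPair, norm_smul, mul_pow, Complex.norm_real, Real.norm_eq_abs, Real.abs_exp,
      ← Real.exp_nat_mul, EuclideanSpace.norm_sq_eq]
    congr 2
    · push_cast; ring
    · simp
  rw [← ofReal_norm, ← ofReal_norm, ← ofReal_norm, ← ENNReal.ofReal_pow (norm_nonneg _),
    ← ENNReal.ofReal_pow (norm_nonneg _), ← ENNReal.ofReal_pow (norm_nonneg _),
    ← ENNReal.ofReal_add (by positivity) (by positivity), ← ENNReal.ofReal_mul (Real.exp_pos y).le, h]

theorem eLpNorm_logPair {f : ℝ → ℂ} (hf : Measurable f) : eLpNorm (logPair f) 2 = eLpNorm f 2 := by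
  have h := lintegral_eq_lintegral_exp (G := fun x => ‖f x‖ₑ ^ 2) (by fun_prop)
  simp only [← enorm_logPair_sq] at h
  rw [eLpNorm_eq_lintegral_rpow_enorm_toReal (by norm_num) (by norm_num),
    eLpNorm_eq_lintegral_rpow_enorm_toReal (by norm_num) (by norm_num)]
  simp only [ENNReal.toReal_ofNat, ENNReal.rpow_ofNat]
  rw [h]

theorem measurable_logPair {f : ℝ → ℂ} (hf : Measurable f) : Measurable (logPair f) := by
  unfold logPair
  fun_prop

theorem logPair_ae_congr {f g : ℝ → ℂ} (h : f =ᵐ[volume] g) : logPair f =ᵐ[volume] logPair g := by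
  filter_upwards [ae_comp_exp h] with y hy
  rw [logPair, logPair, hy.1, hy.2]

theorem memLp_logPair {f : ℝ → ℂ} (hf : Measurable f) (h : MemLp f 2) : MemLp (logPair f) 2 :=
  ⟨(measurable_logPair hf).aestronglyMeasurable, by rw [eLpNorm_logPair hf]; exact h.2⟩

theorem measurable_L2 (f : L2) : Measurable f := (Lp.stronglyMeasurable f).measurable

/-- The isometry `f ↦ (y ↦ e^(y/2) (f(e^y), f(-e^y)))` of `L²(ℝ, ℂ)` into `L²(ℝ, ℂ²)`. -/
noncomputable def logIsometry : L2 →ₗᵢ[ℂ] Lp Pair 2 (volume : Measure ℝ) where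
  toFun f := (memLp_logPair (measurable_L2 f) (Lp.memLp f)).toLp _
  map_add' f g := by
    rw [← MemLp.toLp_add]
    refine MemLp.toLp_congr _ _ ((logPair_ae_congr (Lp.coeFn_add f g)).trans ?_)
    refine Eventually.of_forall fun y => ?_
    simp only [logPair, Pi.add_apply]
    module
  map_smul' c f := by
    rw [RingHom.id_apply, ← MemLp.toLp_const_smul]
    refine MemLp.toLp_congr _ _ ((logPair_ae_congr (Lp.coeFn_smul c f)).trans ?_)
    refine Eventually.of_forall fun y => ?_
    simp only [logPair, Pi.smul_apply, smul_eq_mul]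
    module
  norm_map' f := by
    change ‖(memLp_logPair (measurable_L2 f) (Lp.memLp f)).toLp _‖ = _
    rw [Lp.norm_toLp, eLpNorm_logPair (measurable_L2 f), Lp.norm_def]

theorem logIsometry_coeFn (f : L2) : logIsometry f =ᵐ[volume] logPair f :=
  (memLp_logPair (measurable_L2 f) (Lp.memLp f)).coeFn_toLp

theorem logIsometry_surjective : Function.Surjective logIsometry := by
  intro g
  -- `Real.log x` is `log |x|`, so this single formula covers both half-lines.
  set f : ℝ → ℂ := fun x => ((Real.exp (-(Real.log x) / 2) : ℝ) : ℂ) *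
    g (Real.log x) (if 0 < x then 0 else 1) with hf
  have hg : Measurable g := (Lp.stronglyMeasurable g).measurable
  have hcoord : ∀ i : Fin 2, Measurable fun x => g (Real.log x) i := fun i =>
    (EuclideanSpace.proj (𝕜 := ℂ) i).continuous.measurable.comp (hg.comp Real.measurable_log)
  have hfm : Measurable f := by
    have : Measurable fun x => if 0 < x then g (Real.log x) 0 else g (Real.log x) 1 :=
      Measurable.ite measurableSet_Ioi (hcoord 0) (hcoord 1)
    have e : f = fun x => ((Real.exp (-(Real.log x) / 2) : ℝ) : ℂ) *
        if 0 < x then g (Real.log x) 0 else g (Real.log x) 1 := by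
      funext x
      simp only [hf]
      split_ifs <;> rfl
    rw [e]
    fun_prop
  have hfg : logPair f = g := by
    funext y
    have h1 : f (Real.exp y) = ((Real.exp (-y / 2) : ℝ) : ℂ) * g y 0 := by
      simp only [hf, Real.log_exp, if_pos (Real.exp_pos y)]
    have h2 : f (-Real.exp y) = ((Real.exp (-y / 2) : ℝ) : ℂ) * g y 1 := by
      simp only [hf, Real.log_neg_eq_log, Real.log_exp, if_neg (neg_neg_of_pos (Real.exp_pos y)).not_gt]
    have h3 : ((Real.exp (y / 2) : ℝ) : ℂ) * ((Real.exp (-y / 2) : ℝ) : ℂ) = 1 := by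
      rw [← Complex.ofReal_mul, ← Real.exp_add]
      simp [neg_div]
    rw [logPair, h1, h2]
    ext i
    fin_cases i
    · simp only [PiLp.smul_apply, PiLp.add_apply, smul_eq_mul]
      simp
      push_cast at h3
      linear_combination g y 0 * h3
    · simp only [PiLp.smul_apply, PiLp.add_apply, smul_eq_mul]
      simp
      push_cast at h3
      linear_combination g y 1 * h3
  have hfL : MemLp f 2 :=
    ⟨hfm.aestronglyMeasurable, by rw [← eLpNorm_logPair hfm, hfg]; exact (Lp.memLp g).2⟩
  refine ⟨hfL.toLp f, Lp.ext ?_⟩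
  have := (logIsometry_coeFn (hfL.toLp f)).trans (logPair_ae_congr hfL.coeFn_toLp)
  rwa [hfg] at this

/-- `L²(ℝ, ℂ)` in logarithmic coordinates. -/
noncomputable def logEquiv : L2 ≃ₗᵢ[ℂ] Lp Pair 2 (volume : Measure ℝ) :=
  LinearIsometryEquiv.ofSurjective logIsometry logIsometry_surjective

theorem logEquiv_coeFn (f : L2) : logEquiv f =ᵐ[volume] logPair f := logIsometry_coeFn f

/-! ### The Fourier transform of a derivative in `L²` -/

section FourierDeriv

variable {F : Type*} [NormedAddCommGroup F] [InnerProductSpace ℂ F]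

theorem integrable_inner {f g : ℝ → F} (hf : MemLp f 2) (hg : MemLp g 2) :
    Integrable fun x => inner ℂ (f x) (g x) := by
  refine (L2.integrable_inner (𝕜 := ℂ) (hf.toLp f) (hg.toLp g)).congr ?_
  filter_upwards [hf.coeFn_toLp, hg.coeFn_toLp] with x h1 h2
  rw [h1, h2]

theorem inner_toLp_eq_neg_inner_deriv (k : 𝓢(ℝ, F)) {g g' : ℝ → F} (hg : MemLp g 2)
    (hg' : MemLp g' 2) (hd : ∀ x, HasDerivAt g (g' x) x) :
    inner ℂ (k.toLp 2) (hg'.toLp g') =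
      -inner ℂ ((SchwartzMap.derivCLM ℂ F k).toLp 2) (hg.toLp g) := by
  have h1 : inner ℂ (k.toLp 2) (hg'.toLp g') = ∫ x, inner ℂ (k x) (g' x) := by
    rw [L2.inner_def]
    refine integral_congr_ae ?_
    filter_upwards [k.coeFn_toLp 2 volume, hg'.coeFn_toLp] with x h1 h2
    rw [h1, h2]
  have h2 : inner ℂ ((SchwartzMap.derivCLM ℂ F k).toLp 2) (hg.toLp g) =
      ∫ x, inner ℂ (deriv k x) (g x) := by
    rw [L2.inner_def]
    refine integral_congr_ae ?_
    filter_upwards [(SchwartzMap.derivCLM ℂ F k).coeFn_toLp 2 volume, hg.coeFn_toLp] with x h1 h2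
    rw [h1, h2, SchwartzMap.derivCLM_apply]
  have hk : MemLp k 2 := k.memLp 2 volume
  have hk' : MemLp (deriv k) 2 := (SchwartzMap.derivCLM ℂ F k).memLp 2 volume
  have i1 := integrable_inner hk hg'
  have i2 := integrable_inner hk' hg
  have h3 := integral_eq_zero_of_hasDerivAt_of_integrable
    (f := fun x => inner ℂ (k x) (g x)) (f' := fun x => inner ℂ (k x) (g' x) + inner ℂ (deriv k x) (g x))
    (fun x => k.differentiableAt.hasDerivAt.inner ℂ (hd x)) (i1.add i2) (integrable_inner hk hg)
  rw [integral_add i1 i2] at h3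
  rw [h1, h2]
  exact eq_neg_of_add_eq_zero_left h3

variable [CompleteSpace F]

/-- If `g` and `g'` are in `L²`, the Fourier transform of `g'` is `2πiξ` times that of `g`: both
have the same inner products with Schwartz functions. -/
theorem fourier_toLp_deriv {g g' : ℝ → F} (hg : MemLp g 2) (hg' : MemLp g' 2)
    (hd : ∀ x, HasDerivAt g (g' x) x) :
    (𝓕 (hg'.toLp g') : Lp F 2 (volume : Measure ℝ)) =ᵐ[volume] fun ξ =>
      (2 * Real.pi * Complex.I * ξ : ℂ) • (𝓕 (hg.toLp g) : Lp F 2 (volume : Measure ℝ)) ξ := by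
  set A : Lp F 2 (volume : Measure ℝ) := 𝓕 (hg'.toLp g') with hA
  set B : Lp F 2 (volume : Measure ℝ) := 𝓕 (hg.toLp g) with hB
  have hpair : ∀ h : 𝓢(ℝ, F), ∫ ξ, inner ℂ (h ξ) (A ξ) =
      ∫ ξ : ℝ, inner ℂ (h ξ) ((2 * Real.pi * Complex.I * ξ : ℂ) • B ξ) := by
    intro h
    set k : 𝓢(ℝ, F) := 𝓕⁻ h with hk
    have hkh : 𝓕 k = h := by rw [hk]; exact FourierTransform.fourier_fourierInv_eq h
    have e1 : inner ℂ (h.toLp 2) A = ∫ ξ, inner ℂ (h ξ) (A ξ) := by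
      rw [L2.inner_def]
      refine integral_congr_ae ?_
      filter_upwards [h.coeFn_toLp 2 volume] with x h1
      rw [h1]
    have hFk' : ∀ ξ : ℝ, 𝓕 (SchwartzMap.derivCLM ℂ F k) ξ = (2 * Real.pi * Complex.I * ξ : ℂ) • h ξ := by
      intro ξ
      have h1 := Real.fourier_deriv k.integrable k.differentiable
        (SchwartzMap.derivCLM ℂ F k).integrable
      have h2 := congrFun h1 ξ
      rw [← SchwartzMap.fourier_coe, hkh] at h2
      rw [← h2, SchwartzMap.fourier_coe]
      rfl
    have e2 : inner ℂ (h.toLp 2) A =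
        -∫ ξ : ℝ, inner ℂ ((2 * Real.pi * Complex.I * ξ : ℂ) • h ξ) (B ξ) := by
      rw [← hkh, ← SchwartzMap.toLp_fourier_eq, hA, Lp.inner_fourier_eq,
        inner_toLp_eq_neg_inner_deriv k hg hg' hd, ← Lp.inner_fourier_eq,
        SchwartzMap.toLp_fourier_eq, L2.inner_def]
      congr 1
      refine integral_congr_ae ?_
      filter_upwards [(𝓕 (SchwartzMap.derivCLM ℂ F k)).coeFn_toLp 2 volume] with x h1
      rw [h1, hFk', hkh]
    rw [← e1, e2, ← integral_neg]
    congr 1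
    funext ξ
    rw [inner_smul_left, inner_smul_right]
    simp only [map_mul, map_ofNat, Complex.conj_ofReal, Complex.conj_I]
    ring
  have hξB : LocallyIntegrable (fun ξ : ℝ => (2 * Real.pi * Complex.I * ξ : ℂ) • B ξ) := by
    have hBl : LocallyIntegrable B := (Lp.memLp B).locallyIntegrable (by norm_num)
    have hcont : Continuous fun ξ : ℝ => (2 * Real.pi * Complex.I * ξ : ℂ) := by fun_prop
    rw [← locallyIntegrableOn_univ] at hBl ⊢
    exact hBl.continuousOn_smul isClosed_univ.isLocallyClosed hcont.continuousOn
  have hloc : LocallyIntegrable (fun ξ : ℝ => A ξ - (2 * Real.pi * Complex.I * ξ : ℂ) • B ξ) :=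
    ((Lp.memLp A).locallyIntegrable (by norm_num)).sub hξB
  have hzero := ae_eq_zero_of_integral_contDiff_smul_eq_zero hloc fun φ hφ hφc => by
    have hint : Integrable fun ξ : ℝ => φ ξ • (A ξ - (2 * Real.pi * Complex.I * ξ : ℂ) • B ξ) :=
      hloc.integrable_smul_left_of_hasCompactSupport hφ.continuous hφc
    refine ext_inner_left ℂ fun c => ?_
    rw [inner_zero_right, ← integral_inner hint]
    set h : 𝓢(ℝ, F) := HasCompactSupport.toSchwartzMap (f := fun ξ => φ ξ • c)
      (hφc.smul_right) (hφ.smul contDiff_const) with hh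
    have hval : ∀ ξ, h ξ = φ ξ • c := fun ξ => rfl
    have h1 := hpair h
    have e : ∀ ξ : ℝ, inner ℂ c (φ ξ • (A ξ - (2 * Real.pi * Complex.I * ξ : ℂ) • B ξ)) =
        inner ℂ (h ξ) (A ξ) - inner ℂ (h ξ) ((2 * Real.pi * Complex.I * ξ : ℂ) • B ξ) := by
      intro ξ
      rw [hval, ← inner_sub_right, RCLike.real_smul_eq_coe_smul (K := ℂ),
        RCLike.real_smul_eq_coe_smul (K := ℂ), inner_smul_left, inner_smul_right]
      simp
    simp only [e]
    have hL : MemLp h 2 := h.memLp 2 volume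
    have i1 := integrable_inner hL (Lp.memLp A)
    have i2 : Integrable fun ξ : ℝ => inner ℂ (h ξ) ((2 * Real.pi * Complex.I * ξ : ℂ) • B ξ) := by
      have h2 : Integrable fun ξ : ℝ => φ ξ • ((2 * Real.pi * Complex.I * ξ : ℂ) • B ξ) :=
        hξB.integrable_smul_left_of_hasCompactSupport hφ.continuous hφc
      refine (h2.const_inner c).congr (Eventually.of_forall fun ξ => ?_)
      simp only
      rw [hval, RCLike.real_smul_eq_coe_smul (K := ℂ), RCLike.real_smul_eq_coe_smul (K := ℂ),
        inner_smul_left, inner_smul_right]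
      simp
    rw [integral_sub i1 i2, h1, sub_self]
  filter_upwards [hzero] with ξ hξ
  exact sub_eq_zero.1 hξ

end FourierDeriv

/-! ### A self-adjoint extension -/

/-- The unitary map that turns `XP + PX` into multiplication by `4πξ`: the Fourier transform in
logarithmic coordinates. -/
noncomputable def mellinEquiv : L2 ≃ₗᵢ[ℂ] Lp Pair 2 (volume : Measure ℝ) :=
  logEquiv.trans (Lp.fourierTransformₗᵢ ℝ Pair)

theorem hasDerivAt_logPair {f f' : ℝ → ℂ} (hf : ∀ x, HasDerivAt f (f' x) x) (y : ℝ) :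
    HasDerivAt (logPair f) ((1 / 2 : ℂ) • logPair (fun x => 2 * x * f' x + f x) y) y := by
  have h0 : HasDerivAt (fun y : ℝ => ((Real.exp (y / 2) : ℝ) : ℂ))
      ((Real.exp (y / 2) * (1 / 2) : ℝ) : ℂ) y :=
    (((hasDerivAt_id y).div_const 2).exp).ofReal_comp
  have h1 : HasDerivAt (fun y : ℝ => f (Real.exp y)) (Real.exp y • f' (Real.exp y)) y :=
    (hf _).scomp y (Real.hasDerivAt_exp y)
  have h2 : HasDerivAt (fun y : ℝ => f (-Real.exp y)) (-Real.exp y • f' (-Real.exp y)) y :=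
    (hf _).scomp y (Real.hasDerivAt_exp y).neg
  convert! h0.fun_smul ((h1.smul_const (EuclideanSpace.single (0 : Fin 2) (1 : ℂ))).fun_add
    (h2.smul_const (EuclideanSpace.single (1 : Fin 2) (1 : ℂ)))) using 1
  simp only [logPair, Complex.real_smul]
  push_cast
  module

/-- `2 · (-i d/dy)` in logarithmic coordinates is `XP + PX`. -/
theorem mellinEquiv_anticomm (f : 𝓢(ℝ, ℂ)) :
    mellinEquiv (schwartzToL2 (position (momentum f) + momentum (position f))) =ᵐ[volume]
      fun ξ => ((4 * Real.pi * ξ : ℝ) : ℂ) • mellinEquiv (schwartzToL2 f) ξ := by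
  set A := position (momentum f) + momentum (position f) with hA
  have hAf : ∀ x, Complex.I * A x = 2 * x * deriv f x + f x := fun x => by
    rw [hA, schwartzAnticomm_apply]
    linear_combination (-(2 * x * deriv f x + f x)) * Complex.I_sq
  have hg : MemLp (logPair f) 2 := memLp_logPair f.continuous.measurable (f.memLp 2 volume)
  have hgA : MemLp (logPair A) 2 := memLp_logPair A.continuous.measurable (A.memLp 2 volume)
  have hd : ∀ y, HasDerivAt (logPair f) (((Complex.I / 2) • logPair A) y) y := by
    intro y
    convert! hasDerivAt_logPair (fun x => f.differentiableAt.hasDerivAt) y using 1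
    simp only [logPair, Pi.smul_apply]
    rw [← hAf, ← hAf]
    module
  have hF := fourier_toLp_deriv hg (hgA.const_smul (Complex.I / 2)) hd
  have e1 : logEquiv (schwartzToL2 f) = hg.toLp _ :=
    Lp.ext ((logEquiv_coeFn _).trans ((logPair_ae_congr (schwartzToL2_coeFn f)).trans
      hg.coeFn_toLp.symm))
  have e2 : logEquiv (schwartzToL2 A) = hgA.toLp _ :=
    Lp.ext ((logEquiv_coeFn _).trans ((logPair_ae_congr (schwartzToL2_coeFn A)).trans
      hgA.coeFn_toLp.symm))
  have e3 : ∀ u : L2, mellinEquiv u = 𝓕 (logEquiv u) := fun u => rfl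
  rw [e3, e3, e1, e2]
  rw [MemLp.toLp_const_smul _ hgA, FourierTransform.fourier_smul] at hF
  filter_upwards [hF, Lp.coeFn_smul (Complex.I / 2) (𝓕 (hgA.toLp _) : Lp Pair 2 volume)]
    with ξ h1 h2
  rw [h2, Pi.smul_apply] at h1
  have h3 := congrArg (fun v => (-2 * Complex.I) • v) h1
  simp only [smul_smul] at h3
  have c1 : -2 * Complex.I * (Complex.I / 2) = 1 := by linear_combination -Complex.I_sq
  have c2 : -2 * Complex.I * (2 * Real.pi * Complex.I * ξ) = ((4 * Real.pi * ξ : ℝ) : ℂ) := by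
    push_cast
    linear_combination (-4 * Real.pi * ξ : ℂ) * Complex.I_sq
  rwa [c1, c2, one_smul] at h3

/-- The self-adjoint extension of `XP + PX` given by multiplication by `4πξ` on the side of the
Mellin transform. -/
noncomputable def extension : L2 →ₗ.[ℂ] L2 := diagonal mellinEquiv fun ξ => 4 * Real.pi * ξ

theorem anticomm_le_extension : anticomm ≤ extension := by
  have hmem : ∀ f : 𝓢(ℝ, ℂ), schwartzToL2 f ∈ extension.domain := fun f =>
    (mem_diagonal_domain mellinEquiv).2 (MemLp.ae_eq (mellinEquiv_anticomm f) (Lp.memLp _))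
  refine ⟨?_, ?_⟩
  · rintro _ ⟨f, rfl⟩
    exact hmem f
  · rintro ⟨_, f, rfl⟩ ⟨y, hy⟩ h
    have h' : schwartzToL2 f = y := h
    subst h'
    have e := anticomm_apply f
    refine e.trans (mellinEquiv.injective (Lp.ext ?_))
    exact (mellinEquiv_anticomm f).trans (map_diagonal_coeFn mellinEquiv ⟨_, hmem f⟩).symm

/-! ### The vacuum distribution -/

theorem integrable_betaCombination : Integrable betaCombination := by
  have hc : (1 - Complex.I) / (8 * Real.pi) ≠ 0 := by
    refine div_ne_zero (fun h => ?_) (by simp [Real.pi_ne_zero])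
    simpa using congrArg Complex.re h
  have h := integrable_vacuumDensity
  rw [funext vacuumDensity_eq_betaCombination] at h
  exact (integrable_const_mul_iff hc.isUnit _).1 h

theorem inner_vacuum_proj {T : L2 →ₗ.[ℂ] L2} {E : ResolutionOfIdentity L2}
    (hT : IsSelfAdjoint T) (hA : anticomm ≤ T) (hE : E.IsResolutionOf T) (l : ℝ) :
    inner ℂ vacuum (E.proj l vacuum) =
      (1 - Complex.I) / (8 * Real.pi) * ∫ t in Set.Iic l, betaCombination t := by
  have hreal : ∀ x, ((vacuumDensity x).re : ℂ) = vacuumDensity x := fun x =>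
    Complex.conj_eq_iff_re.1 (conj_vacuumDensity x)
  have h := real_Iic_eq_integral_of_charFun (μ := E.measure vacuum)
    integrable_vacuumDensity.re (fun t => ?_) l
  · rw [Measure.real, E.measure_Iic, ENNReal.toReal_ofReal (by positivity)] at h
    rw [E.inner_self_proj, h, ← integral_const_mul, ← integral_complex_ofReal]
    refine setIntegral_congr_fun measurableSet_Iic fun x _ => ?_
    rw [← vacuumDensity_eq_betaCombination]
    exact hreal x
  · have h1 := integral_exp_measure_vacuum hT hA hE t
    have h2 : ∀ x : ℝ, Complex.exp (t * x * Complex.I) = Complex.exp (Complex.I * t * x) := fun x => by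
      ring_nf
    rw [charFun_apply_real]
    simp only [h2]
    rw [h1, ← integral_exp_mul_vacuumDensity]
    congr 1
    funext x
    rw [h2]
    congr 1
    exact (hreal x).symm

end Anticommutator

/-- The vacuum spectral resolution and the vacuum characteristic function of `XP + PX`. -/
theorem theorem2p4 :
    -- self-adjoint extensions `T` of `XP + PX`, their spectral resolutions `E` and the
    -- operators `e^{itT}` exist,
    (∃ (T : Anticommutator.L2 →ₗ.[ℂ] Anticommutator.L2)
        (E : Anticommutator.ResolutionOfIdentity Anticommutator.L2),
      IsSelfAdjoint T ∧ Anticommutator.anticomm ≤ T ∧ E.IsResolutionOf T ∧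
        ∀ t : ℝ, ∃ U : Anticommutator.L2 →L[ℂ] Anticommutator.L2, E.IsExp t U) ∧
    -- and for all of them the two formulas hold;
    (∀ (T : Anticommutator.L2 →ₗ.[ℂ] Anticommutator.L2)
        (E : Anticommutator.ResolutionOfIdentity Anticommutator.L2),
      IsSelfAdjoint T → Anticommutator.anticomm ≤ T → E.IsResolutionOf T →
        (∀ l : ℝ,
          MeasureTheory.IntegrableOn Anticommutator.betaCombination (Set.Iic l) ∧
          inner ℂ Anticommutator.vacuum (E.proj l Anticommutator.vacuum) =
            (1 - Complex.I) / (8 * Real.pi) *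
              ∫ t in Set.Iic l, Anticommutator.betaCombination t) ∧
        ∀ (t : ℝ) (U : Anticommutator.L2 →L[ℂ] Anticommutator.L2), E.IsExp t U →
          inner ℂ Anticommutator.vacuum (U Anticommutator.vacuum) =
            (((1 / Real.cosh (2 * t)) ^ (1 / 2 : ℝ) : ℝ) : ℂ)) ∧
    -- here the incomplete Beta function has its power series.
    (∀ (z a : ℂ) (b : ℝ), 0 < a.re → (‖z‖ < 1 ∨ ‖z‖ ≤ 1 ∧ 0 < b) →
      HasSum
        (fun n : ℕ => z ^ a * (((ascPochhammer ℂ n).eval (1 - (b : ℂ)) /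
          ((n.factorial : ℂ) * (a + n))) * z ^ n))
        (Anticommutator.incompleteBeta z a b)) := by
  refine ⟨⟨Anticommutator.extension,
    Anticommutator.diagonalResolution Anticommutator.mellinEquiv (by fun_prop),
    Anticommutator.isSelfAdjoint_diagonal _ (by fun_prop), Anticommutator.anticomm_le_extension,
    Anticommutator.isResolutionOf_diagonal _ _, Anticommutator.isExp_diagonalResolution _ _⟩,
    fun T E hT hA hE => ⟨fun l => ⟨Anticommutator.integrable_betaCombination.integrableOn,
      Anticommutator.inner_vacuum_proj hT hA hE l⟩, fun t U hU => ?_⟩,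
    fun z a b ha h => Anticommutator.hasSum_incompleteBeta ha h⟩
  rw [hU Anticommutator.vacuum]
  exact Anticommutator.integral_exp_measure_vacuum hT hA hE t
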